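/- **Conventions.** A commutative ring $R$ is given to algorithms by a surjection $\nu : N \to R$ from a set $N$ of finite codes ("names"); "algorithm" means a total recursive function on names. We say that $R$ (with $\nu$) is *computable* if equality is decidable and addition, negation and multiplication are computable on names, and if there is one algorithm which, given $r,p,q\in\mathbb{N}$ and matrices $A\in R^{p\times q}$, $\mathcal B\in R^{r\times q}$, decides whether $\mathcal B=XA$ has a solution $X\in R^{r\times p}$ and, if so, returns a finite affine generating set of all solutions: a solution $X_0$ and finitely many matrices $X_1,\dots,X_m$ such that the solution set is $X_0+\langle X_1,\dots,X_m\rangle_R$. We say that $R$ has *effective coset representatives* if for every ideal $I$ of $R$ there is a set $T_I\subseteq R$ containing exactly one element of each coset of $I$, and there is one algorithm which, given finitely many generators of an ideal $I$ and an element $b\in R$, computes the unique $t\in T_I$ with $b+I=t+I$. A $\mathbb{Z}$-graded ring $S=\bigoplus_{d} S_d$ is *computable as a graded ring* if it is computable, if $a\in S_d$ is decidable for $a\in S$ and $d\in\mathbb{Z}$, and if there is one algorithm which, given a homogeneous linear system $\mathcal B=XA$, that is, $A\in S^{p\times q}$, $\mathcal B\in S^{r\times q}$ and $c\in\mathbb{Z}^r$,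 $d\in\mathbb{Z}^p$, $e\in\mathbb{Z}^q$ with $A_{ij}\in S_{d_i-e_j}$ and $\mathcal B_{kj}\in S_{c_k-e_j}$, decides whether it is solvable and, if so, returns a homogeneous affine generating set of all solutions: a solution $X_0$ with $(X_0)_{ki}\in S_{c_k-d_i}$, and finitely many pairs $(s_l,X_l)$ with $s_l\in\mathbb{Z}$ and $(X_l)_{ki}\in S_{s_l+c_k-d_i}$ such that the solution set is $X_0+\langle X_1,\dots,X_m\rangle_S$. **Proposition.** Let $B$ be a Noetherian commutative ring that is computable and has effective coset representatives, and let $n\ge 0$. Let $S=B[x_0,\dots,x_n]$ be $\mathbb{Z}$-graded by $\deg x_0=\dots=\deg x_n=1$ and $\deg b=0$ for $b\in B\setminus\{0\}$, where polynomials are named by finite lists of terms (a name of a coefficient in $B$ together with an exponent vector). Then $S$ is computable as a graded ring and has effective coset representatives. -/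

import Mathlib

/-!
Rings are presented to algorithms through *names*: a ring `R` comes with a map `ν : N → R` from a
type `N` of finite codes onto `R`.  "Algorithm" means a (total) recursive function between codes, in
the sense of `Computable`.
-/

section Names

variable {N R : Type*} [CommRing R]

/-- The `r × p` matrix over `R` named by a list of rows of names.  Missing entries are read as `0`
and superfluous ones are ignored, so each matrix has a name and every list of lists is a name. -/
def matrixOfNames (ν : N → R) (r p : ℕ) (l : List (List N)) : Matrix (Fin r) (Fin p) R :=
  fun i j => ((l[(i : ℕ)]?).bind fun row => row[(j : ℕ)]?).elim 0 ν

/-- All solutions `X` of the linear system `B = X A`. -/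
def solutionSet {r p q : ℕ} (A : Matrix (Fin p) (Fin q) R) (B : Matrix (Fin r) (Fin q) R) :
    Set (Matrix (Fin r) (Fin p) R) :=
  {X | B = X * A}

/-- The affine `R`-subspace through `X₀` whose space of directions is generated by the list `L`. -/
def affineSpan₀ {M : Type*} [AddCommGroup M] [Module R M] (X₀ : M) (L : List M) : Set M :=
  {X | ∃ Y ∈ Submodule.span R {Z | Z ∈ L}, X = X₀ + Y}

/-- The ring presented by `ν` can be worked with on a machine: every element has a name, equality
is decidable, and addition, negation and multiplication are computable on names. -/
structure HasEffectiveArithmetic [Primcodable N] (ν : N → R) : Prop where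
  surjective : Function.Surjective ν
  decidable_eq : ComputablePred fun x : N × N => ν x.1 = ν x.2
  add : ∃ f : N × N → N, Computable f ∧ ∀ x y, ν (f (x, y)) = ν x + ν y
  neg : ∃ f : N → N, Computable f ∧ ∀ x, ν (f x) = -ν x
  mul : ∃ f : N × N → N, Computable f ∧ ∀ x y, ν (f (x, y)) = ν x * ν y

/-- A linear system `B = X A` as the input of an algorithm: `((r, p, q), A, B)`, where `A` is a name
of a `p × q` matrix and `B` a name of an `r × q` matrix, so that `X` is an `r × p` matrix. -/
abbrev SystemName (N : Type*) := (ℕ × ℕ × ℕ) × List (List N) × List (List N)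

/-- `R`, presented by `ν`, is a computable ring: one algorithm receives an arbitrary linear system
`B = X A` and returns `none` if the system has no solution, and otherwise a particular solution
together with a finite list of generators of the space of directions of the solution set. -/
structure IsComputableRing [Primcodable N] (ν : N → R) : Prop extends
    HasEffectiveArithmetic ν where
  solve : ∃ f : SystemName N → Option (List (List N) × List (List (List N))), Computable f ∧
    ∀ (r p q : ℕ) (A B : List (List N)),
      match f ((r, p, q), A, B) with
      | none => solutionSet (matrixOfNames ν p q A) (matrixOfNames ν r q B) = ∅
      | some (X₀, L) =>
          solutionSet (matrixOfNames ν p q A) (matrixOfNames ν r q B) =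
            affineSpan₀ (R := R) (matrixOfNames ν r p X₀) (L.map (matrixOfNames ν r p))

/-- `R`, presented by `ν`, has effective coset representatives: every ideal `I` has a set `T I`
containing exactly one element of each coset of `I`, and one algorithm computes, from finitely many
generators of `I` and an element `b`, the element of `T I` in the coset of `b`. -/
def HasEffectiveCosetRepresentatives [Primcodable N] (ν : N → R) : Prop :=
  ∃ T : Ideal R → Set R,
    (∀ (I : Ideal R) (b : R), ∃! t, t ∈ T I ∧ b - t ∈ I) ∧
    ∃ f : List N × N → N, Computable f ∧
      ∀ (l : List N) (b : N),
        ν (f (l, b)) ∈ T (Ideal.span {g | ∃ x ∈ l, ν x = g}) ∧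
          ν b - ν (f (l, b)) ∈ Ideal.span {g | ∃ x ∈ l, ν x = g}

end Names

section Graded

variable {N R σ : Type*} [CommRing R] [SetLike σ R]

/-- A matrix `X` is homogeneous of degree `s` with respect to row degrees `c` and column degrees
`d` if `v ↦ v X` is a homogeneous map of degree `s` from the graded free module with basis degrees
`c` to the graded free module with basis degrees `d`; that is, `X i j` is homogeneous of degree
`s + c i - d j`. -/
def IsHomogeneousMatrix (𝒜 : ℤ → σ) {r p : ℕ} (c : Fin r → ℤ) (d : Fin p → ℤ) (s : ℤ)
    (X : Matrix (Fin r) (Fin p) R) : Prop :=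
  ∀ i j, X i j ∈ 𝒜 (s + c i - d j)

/-- The tuple of degrees described by a list of integers (missing entries are read as `0`). -/
def degreesOfList (r : ℕ) (l : List ℤ) : Fin r → ℤ := fun i => l.getD i 0

/-- `R`, presented by `ν`, is computable as a `ℤ`-graded ring: it is a computable ring, it is
decidable whether an element is homogeneous of a given degree, and one algorithm receives a linear
system `B = X A` together with degrees `(c, d, e)` for which it is homogeneous (`c`: rows of `B`,
`d`: rows of `A`, `e`: columns of `A` and of `B`) and returns a *homogeneous* generating set of the
affine space of solutions: `none` if the system has no solution, and otherwise a solution that is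
homogeneous of degree `0` together with a finite list of generators of the space of directions,
each of them homogeneous and listed with its degree. -/
structure IsComputableGradedRing [Primcodable N] (ν : N → R) [AddSubmonoidClass σ R] (𝒜 : ℤ → σ)
    [GradedRing 𝒜] : Prop extends IsComputableRing ν where
  decidable_mem : ComputablePred fun x : N × ℤ => ν x.1 ∈ 𝒜 x.2
  solve_homogeneous :
    ∃ f : SystemName N × (List ℤ × List ℤ × List ℤ) →
        Option (List (List N) × List (ℤ × List (List N))), Computable f ∧
      ∀ (r p q : ℕ) (A B : List (List N)) (c d e : List ℤ),
        IsHomogeneousMatrix 𝒜 (degreesOfList p d) (degreesOfList q e) 0 (matrixOfNames ν p q A) →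
        IsHomogeneousMatrix 𝒜 (degreesOfList r c) (degreesOfList q e) 0 (matrixOfNames ν r q B) →
        match f (((r, p, q), A, B), (c, d, e)) with
        | none => solutionSet (matrixOfNames ν p q A) (matrixOfNames ν r q B) = ∅
        | some (X₀, L) =>
            IsHomogeneousMatrix 𝒜 (degreesOfList r c) (degreesOfList p d) 0
              (matrixOfNames ν r p X₀) ∧
            (∀ Y ∈ L, IsHomogeneousMatrix 𝒜 (degreesOfList r c) (degreesOfList p d) Y.1
              (matrixOfNames ν r p Y.2)) ∧
            solutionSet (matrixOfNames ν p q A) (matrixOfNames ν r q B) =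
              affineSpan₀ (R := R) (matrixOfNames ν r p X₀)
                (L.map fun Y => matrixOfNames ν r p Y.2)

end Graded

section Polynomials

variable {N B : Type*} [CommRing B]

/-- The exponent vector `(e₀, …, eₙ)` described by a list (missing entries are read as `0`). -/
noncomputable def exponentOfList (n : ℕ) (e : List ℕ) : Fin (n + 1) →₀ ℕ :=
  Finsupp.equivFunOnFinite.symm fun i => e.getD i 0

/-- The usual presentation of `B[x₀, …, xₙ]` built from a presentation `ν` of `B`: a list of pairs
(name of a coefficient `b`, exponent vector `e`) names the sum of the terms `b x₀^e₀ ⋯ xₙ^eₙ`. -/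
noncomputable def polynomialOfNames (ν : N → B) (n : ℕ) (l : List (N × List ℕ)) :
    MvPolynomial (Fin (n + 1)) B :=
  (l.map fun t => MvPolynomial.monomial (exponentOfList n t.2) (ν t.1)).sum

/-- The standard `ℤ`-grading of `B[x₀, …, xₙ]`: every `xᵢ` has degree `1`, constants have
degree `0`. -/
noncomputable abbrev standardGrading (B : Type*) [CommRing B] (n : ℕ) :
    ℤ → Submodule B (MvPolynomial (Fin (n + 1)) B) :=
  MvPolynomial.weightedHomogeneousSubmodule B fun _ : Fin (n + 1) => (1 : ℤ)

noncomputable instance standardGrading.gradedRing (B : Type*) [CommRing B] (n : ℕ) :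
    GradedRing (standardGrading B n) :=
  MvPolynomial.weightedGradedAlgebra B fun _ : Fin (n + 1) => (1 : ℤ)

end Polynomials

section ComputableToolkit

variable {α β γ σ τ : Type*} [Primcodable α] [Primcodable β] [Primcodable γ] [Primcodable σ]
  [Primcodable τ]

attribute [fun_prop] Computable Computable.id Computable.const Computable.comp Computable.pair
  Computable.cond

namespace Computable

@[fun_prop]
theorem fst_comp {f : α → β × γ} (hf : Computable f) : Computable fun a => (f a).1 :=
  Computable.fst.comp hf

@[fun_prop]
theorem snd_comp {f : α → β × γ} (hf : Computable f) : Computable fun a => (f a).2 :=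
  Computable.snd.comp hf

@[fun_prop]
theorem nat_add {f g : α → ℕ} (hf : Computable f) (hg : Computable g) :
    Computable fun a => f a + g a :=
  (Primrec.nat_add.to_comp : Computable₂ _).comp hf hg

@[fun_prop]
theorem nat_mul {f g : α → ℕ} (hf : Computable f) (hg : Computable g) :
    Computable fun a => f a * g a :=
  (Primrec.nat_mul.to_comp : Computable₂ _).comp hf hg

@[fun_prop]
theorem nat_sub {f g : α → ℕ} (hf : Computable f) (hg : Computable g) :
    Computable fun a => f a - g a :=
  (Primrec.nat_sub.to_comp : Computable₂ _).comp hf hg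

@[fun_prop]
theorem nat_div {f g : α → ℕ} (hf : Computable f) (hg : Computable g) :
    Computable fun a => f a / g a :=
  (Primrec.nat_div.to_comp : Computable₂ _).comp hf hg

@[fun_prop]
theorem nat_mod {f g : α → ℕ} (hf : Computable f) (hg : Computable g) :
    Computable fun a => f a % g a :=
  (Primrec.nat_mod.to_comp : Computable₂ _).comp hf hg

@[fun_prop]
theorem nat_max {f g : α → ℕ} (hf : Computable f) (hg : Computable g) :
    Computable fun a => max (f a) (g a) :=
  (Primrec.nat_max.to_comp : Computable₂ _).comp hf hg

@[fun_prop]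
theorem decide_nat_le {f g : α → ℕ} (hf : Computable f) (hg : Computable g) :
    Computable fun a => decide (f a ≤ g a) :=
  (Primrec.to_comp (primrecRel_iff_primrec_decide.1 Primrec.nat_le)).comp (hf.pair hg)

@[fun_prop]
theorem decide_eq [DecidableEq β] {f g : α → β} (hf : Computable f) (hg : Computable g) :
    Computable fun a => decide (f a = g a) :=
  (Primrec.to_comp (primrecRel_iff_primrec_decide.1 (Primrec.eq (α := β)))).comp (hf.pair hg)

@[fun_prop]
theorem bool_and {f g : α → Bool} (hf : Computable f) (hg : Computable g) :
    Computable fun a => f a && g a :=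
  (Primrec.and.to_comp : Computable₂ _).comp hf hg

@[fun_prop]
theorem option_elim {f : α → Option β} {g : α → σ} {h : α → β → σ} (hf : Computable f)
    (hg : Computable g) (hh : Computable fun x : α × β => h x.1 x.2) :
    Computable fun a => (f a).elim (g a) (h a) := by
  refine (Computable.option_casesOn hf hg (g := h) hh).of_eq fun a => ?_
  cases f a <;> rfl

@[fun_prop]
theorem option_map_comp {f : α → Option β} {h : α → β → σ} (hf : Computable f)
    (hh : Computable fun x : α × β => h x.1 x.2) : Computable fun a => (f a).map (h a) :=
  Computable.option_map hf hh

@[fun_prop]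
theorem option_bind_comp {f : α → Option β} {h : α → β → Option σ} (hf : Computable f)
    (hh : Computable fun x : α × β => h x.1 x.2) : Computable fun a => (f a).bind (h a) :=
  Computable.option_bind hf hh

@[fun_prop]
theorem option_getD_comp {f : α → Option β} {g : α → β} (hf : Computable f) (hg : Computable g) :
    Computable fun a => (f a).getD (g a) :=
  Computable.option_getD hf hg

@[fun_prop]
theorem option_isSome {f : α → Option β} (hf : Computable f) : Computable fun a => (f a).isSome :=
  Primrec.option_isSome.to_comp.comp hf

@[fun_prop]
theorem list_getElem?_comp {f : α → List β} {g : α → ℕ} (hf : Computable f) (hg : Computable g) :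
    Computable fun a => (f a)[g a]? :=
  Computable.list_getElem?.comp hf hg

@[fun_prop]
theorem list_getD {f : α → List β} {g : α → ℕ} {d : α → β} (hf : Computable f) (hg : Computable g)
    (hd : Computable d) : Computable fun a => (f a).getD (g a) (d a) := by
  simp only [List.getD_eq_getElem?_getD]
  fun_prop

@[fun_prop]
theorem list_length_comp {f : α → List β} (hf : Computable f) : Computable fun a => (f a).length :=
  Computable.list_length.comp hf

@[fun_prop]
theorem list_cons_comp {f : α → β} {g : α → List β} (hf : Computable f) (hg : Computable g) :
    Computable fun a => f a :: g a :=
  Computable.list_cons.comp hf hg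

@[fun_prop]
theorem list_append_comp {f g : α → List β} (hf : Computable f) (hg : Computable g) :
    Computable fun a => f a ++ g a :=
  Computable.list_append.comp hf hg

@[fun_prop]
theorem list_tail {f : α → List β} (hf : Computable f) : Computable fun a => (f a).tail :=
  Primrec.list_tail.to_comp.comp hf

@[fun_prop]
theorem list_range {f : α → ℕ} (hf : Computable f) : Computable fun a => List.range (f a) :=
  Primrec.list_range.to_comp.comp hf

theorem list_foldl {f : α → List β} {g : α → σ} {h : α → σ → β → σ}
    (hf : Computable f) (hg : Computable g)
    (hh : Computable fun x : α × σ × β => h x.1 x.2.1 x.2.2) :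
    Computable fun a => (f a).foldl (h a) (g a) := by
  have step : Computable fun x : α × ℕ × σ => ((f x.1)[x.2.1]?).elim x.2.2 (h x.1 x.2.2) :=
    option_elim (by fun_prop) (by fun_prop)
      (hh.comp (g := fun y : (α × ℕ × σ) × β => (y.1.1, y.1.2.2, y.2)) (by fun_prop))
  refine (Computable.nat_rec (list_length_comp hf) hg
    (h := fun a p => ((f a)[p.1]?).elim p.2 (h a p.2)) step).of_eq fun a => ?_
  have key (n : ℕ) (hn : n ≤ (f a).length) : Nat.rec (motive := fun _ => σ) (g a)
      (fun i s => ((f a)[i]?).elim s (h a s)) n = ((f a).take n).foldl (h a) (g a) := by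
    induction n with
    | zero => rfl
    | succ n ih =>
      have hn' : n < (f a).length := hn
      rw [List.take_add_one, List.foldl_append, ← ih hn'.le]
      change ((f a)[n]?).elim _ _ = _
      rw [List.getElem?_eq_getElem hn']
      rfl
  simpa only [List.take_length] using key _ le_rfl

@[fun_prop]
theorem list_flatMap {f : α → List β} {g : α → β → List σ} (hf : Computable f)
    (hg : Computable fun x : α × β => g x.1 x.2) : Computable fun a => (f a).flatMap (g a) := by
  have h : Computable fun a => (f a).foldl (fun s b => s ++ g a b) [] :=
    list_foldl hf (by fun_prop) (list_append_comp (by fun_prop)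
      (hg.comp (g := fun x : α × List σ × β => (x.1, x.2.2)) (by fun_prop)))
  refine h.of_eq fun a => ?_
  rw [← List.nil_append (List.flatMap _ _)]
  generalize ([] : List σ) = s
  induction f a generalizing s with
  | nil => simp
  | cons b l ih => simp [ih]

@[fun_prop]
theorem list_map {f : α → List β} {g : α → β → σ} (hf : Computable f)
    (hg : Computable fun x : α × β => g x.1 x.2) : Computable fun a => (f a).map (g a) := by
  refine (list_flatMap hf (g := fun a b => [g a b]) (by fun_prop)).of_eq fun a => ?_
  induction f a with
  | nil => rfl
  | cons b l ih => simp_all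

@[fun_prop]
theorem list_filter {f : α → List β} {g : α → β → Bool} (hf : Computable f)
    (hg : Computable fun x : α × β => g x.1 x.2) : Computable fun a => (f a).filter (g a) := by
  refine (list_flatMap hf (g := fun a b => bif g a b then [b] else []) (by fun_prop)).of_eq
    fun a => ?_
  induction f a with
  | nil => rfl
  | cons b l ih => rw [List.flatMap_cons, ih]; cases h : g a b <;> simp [h]

@[fun_prop]
theorem list_all {f : α → List β} {g : α → β → Bool} (hf : Computable f)
    (hg : Computable fun x : α × β => g x.1 x.2) : Computable fun a => (f a).all (g a) := by
  have h : Computable fun a => (f a).foldl (fun s b => s && g a b) true :=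
    list_foldl hf (by fun_prop) (bool_and (by fun_prop)
      (hg.comp (g := fun x : α × Bool × β => (x.1, x.2.2)) (by fun_prop)))
  refine h.of_eq fun a => ?_
  rw [← Bool.true_and (List.all _ _)]
  generalize true = s
  induction f a generalizing s with
  | nil => simp
  | cons b l ih => simp [ih, Bool.and_assoc]

@[fun_prop]
theorem list_foldr {f : α → List β} {g : α → σ} {h : α → β → σ → σ}
    (hf : Computable f) (hg : Computable g)
    (hh : Computable fun x : α × β × σ => h x.1 x.2.1 x.2.2) :
    Computable fun a => (f a).foldr (h a) (g a) := by
  have := list_foldl (h := fun a s b => h a b s) (Computable.list_reverse.comp hf) hg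
    (hh.comp (g := fun x : α × σ × β => (x.1, x.2.2, x.2.1)) (by fun_prop))
  simpa only [List.foldl_reverse] using this

@[fun_prop]
theorem list_nat_sum {f : α → List ℕ} (hf : Computable f) : Computable fun a => (f a).sum :=
  list_foldr (h := fun _ => (· + ·)) hf (const 0) (by fun_prop)

theorem exists_nat_search {p : α → ℕ → Bool} (hp : Computable fun x : α × ℕ => p x.1 x.2)
    (h : ∀ a, ∃ n, p a n = true) :
    ∃ f : α → ℕ, Computable f ∧ ∀ a, p a (f a) = true ∧ ∀ n < f a, p a n = false := by
  refine ⟨fun a => Nat.find (h a), ?_, fun a => ⟨Nat.find_spec (h a), fun n hn => ?_⟩⟩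
  · refine Partrec.of_eq_tot (Partrec.rfind (p := fun a n => Part.some (p a n)) hp) fun a => ?_
    refine Nat.mem_rfind.2 ⟨by simpa using (Nat.find_spec (h a)).symm, fun hm => ?_⟩
    simpa using Nat.find_min (h a) hm
  · simpa using Nat.find_min (h a) hn

theorem of_int {f : ℤ → β} (h₁ : Computable fun n : ℕ => f n)
    (h₂ : Computable fun n : ℕ => f (-(n : ℤ) - 1)) : Computable f := by
  have e₁ (n : ℕ) : Encodable.encode (n : ℤ) = 2 * n := Nat.bit_false_apply n
  have e₂ (n : ℕ) : Encodable.encode (Int.negSucc n) = 2 * n + 1 := Nat.bit_true_apply n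
  have h : Computable fun n : ℕ =>
      bif decide (n % 2 = 0) then f ((n / 2 : ℕ) : ℤ) else f (-((n / 2 : ℕ) : ℤ) - 1) :=
    Computable.cond (by fun_prop) (h₁.comp (g := fun n => n / 2) (by fun_prop))
      (h₂.comp (g := fun n => n / 2) (by fun_prop))
  refine (h.comp Computable.encode).of_eq fun z => ?_
  obtain n | n := z
  · simp [e₁]
  · rw [e₂, show (2 * n + 1) / 2 = n by lia, show (2 * n + 1) % 2 = 1 by lia]
    exact congrArg f (by lia)

@[fun_prop]
theorem int_toNat {f : α → ℤ} (hf : Computable f) : Computable fun a => (f a).toNat :=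
  (of_int (f := Int.toNat) (Computable.id.of_eq fun n => by simp)
    ((Computable.const 0).of_eq fun n => by lia)).comp hf

@[fun_prop]
theorem int_neg_toNat {f : α → ℤ} (hf : Computable f) : Computable fun a => (-f a).toNat :=
  (of_int (f := fun z => (-z).toNat) ((Computable.const 0).of_eq fun n => by lia)
    (Computable.succ.of_eq fun n => by lia)).comp hf

theorem int_natCast_sub {f g : α → ℕ} (hf : Computable f) (hg : Computable g) :
    Computable fun a => (f a : ℤ) - g a := by
  have h₁ (n : ℕ) : Encodable.encode (n : ℤ) = 2 * n := Nat.bit_false_apply n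
  have h₂ (n : ℕ) : Encodable.encode (Int.negSucc n) = 2 * n + 1 := Nat.bit_true_apply n
  have h : Computable fun a => bif decide (g a ≤ f a) then
    2 * (f a - g a) else 2 * (g a - f a - 1) + 1 := by fun_prop
  refine Computable.encode_iff.1 (h.of_eq fun a => ?_)
  obtain h | h := le_or_gt (g a) (f a)
  · rw [decide_eq_true h, cond_true, ← Nat.cast_sub h, h₁]
  · rw [decide_eq_false h.not_ge, cond_false,
      show (f a : ℤ) - g a = Int.negSucc (g a - f a - 1) by lia, h₂]

@[fun_prop]
theorem int_natCast {f : α → ℕ} (hf : Computable f) : Computable fun a => (f a : ℤ) :=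
  (int_natCast_sub hf (const 0)).of_eq fun a => by simp

theorem int_add {f g : α → ℤ} (hf : Computable f) (hg : Computable g) :
    Computable fun a => f a + g a :=
  (int_natCast_sub (f := fun a => (f a).toNat + (g a).toNat)
    (g := fun a => (-f a).toNat + (-g a).toNat) (by fun_prop) (by fun_prop)).of_eq
    fun a => by lia

theorem int_sub {f g : α → ℤ} (hf : Computable f) (hg : Computable g) :
    Computable fun a => f a - g a :=
  (int_natCast_sub (f := fun a => (f a).toNat + (-g a).toNat)
    (g := fun a => (-f a).toNat + (g a).toNat) (by fun_prop) (by fun_prop)).of_eq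
    fun a => by lia

end Computable

end ComputableToolkit

section BoundedDegree

open Polynomial

variable {R : Type*} [CommRing R] {r p q : Type*}

/-- The matrices of polynomials of degree less than `n`. -/
def matrixDegreeLT (R r p : Type*) [CommRing R] (n : ℕ) : Submodule R (Matrix r p R[X]) where
  carrier := {V | ∀ i j, V i j ∈ degreeLT R n}
  add_mem' hV hW i j := add_mem (hV i j) (hW i j)
  zero_mem' _ _ := zero_mem _
  smul_mem' a _ hV i j := Submodule.smul_mem _ a (hV i j)

theorem mem_degreeLT_iff_coeff {n : ℕ} {P : R[X]} :
    P ∈ degreeLT R n ↔ ∀ k, n ≤ k → P.coeff k = 0 := by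
  rw [mem_degreeLT, degree_lt_iff_coeff_zero]

theorem mem_matrixDegreeLT {n : ℕ} {V : Matrix r p R[X]} :
    V ∈ matrixDegreeLT R r p n ↔ ∀ i j k, n ≤ k → (V i j).coeff k = 0 :=
  forall₂_congr fun _ _ => mem_degreeLT_iff_coeff

theorem matrixDegreeLT_mono {m n : ℕ} (h : m ≤ n) :
    matrixDegreeLT R r p m ≤ matrixDegreeLT R r p n :=
  fun _ hV i j => degreeLT_mono h (hV i j)

theorem X_smul_mem_matrixDegreeLT {n : ℕ} {V : Matrix r p R[X]} (hV : V ∈ matrixDegreeLT R r p n) :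
    (X : R[X]) • V ∈ matrixDegreeLT R r p (n + 1) := by
  rw [mem_matrixDegreeLT] at *
  intro i j k hk
  obtain ⟨k, rfl⟩ := Nat.exists_eq_add_of_le' (Nat.one_le_of_lt hk)
  simpa [coeff_X_mul] using hV i j k (by lia)

theorem X_pow_smul_mem_matrixDegreeLT {n : ℕ} {V : Matrix r p R[X]}
    (hV : V ∈ matrixDegreeLT R r p n) (m : ℕ) :
    (X ^ m : R[X]) • V ∈ matrixDegreeLT R r p (n + m) := by
  induction m with
  | zero => simpa
  | succ m ih => simpa only [pow_succ', mul_smul, add_assoc] using X_smul_mem_matrixDegreeLT ih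

theorem exists_mem_matrixDegreeLT [Finite r] [Finite p] (V : Matrix r p R[X]) :
    ∃ n, V ∈ matrixDegreeLT R r p n := by
  cases nonempty_fintype r
  cases nonempty_fintype p
  refine ⟨Finset.univ.sup fun i => Finset.univ.sup fun j => (V i j).natDegree + 1, fun i j => ?_⟩
  refine mem_degreeLT.2 (degree_le_natDegree.trans_lt (Nat.cast_lt.2 (Nat.lt_of_succ_le ?_)))
  exact (Finset.le_sup (f := fun j => (V i j).natDegree + 1) (Finset.mem_univ j)).trans
    (Finset.le_sup (f := fun i => Finset.univ.sup fun j => (V i j).natDegree + 1)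
      (Finset.mem_univ i))

variable [Fintype p]

theorem mul_mem_matrixDegreeLT {d E : ℕ} {A : Matrix p q R[X]} {V : Matrix r p R[X]}
    (hV : V ∈ matrixDegreeLT R r p E) (hA : A ∈ matrixDegreeLT R p q (d + 1)) :
    V * A ∈ matrixDegreeLT R r q (d + E) := by
  intro i j
  rw [Matrix.mul_apply]
  refine sum_mem fun k _ => mem_degreeLT_iff_coeff.2 fun m hm => ?_
  rw [coeff_mul]
  refine Finset.sum_eq_zero fun x hx => ?_
  have hx := Finset.HasAntidiagonal.mem_antidiagonal.1 hx
  obtain h | h := le_or_gt E x.1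
  · rw [mem_degreeLT_iff_coeff.1 (hV i k) _ h, zero_mul]
  · rw [mem_degreeLT_iff_coeff.1 (hA k j) x.2 (by lia), mul_zero]

/-- The products `V * A` of degree less than `d` with `V` of degree less than `E` stay of this form
when they are multiplied by the variable. -/
def IsSaturatedBound (r : Type*) (A : Matrix p q R[X]) (d E : ℕ) : Prop :=
  ∀ V ∈ matrixDegreeLT R r p E, V * A ∈ matrixDegreeLT R r q d →
    ∃ W ∈ matrixDegreeLT R r p E, (X : R[X]) • (V * A) = W * A

theorem exists_isSaturatedBound [Finite r] [Finite q] [IsNoetherianRing R] (A : Matrix p q R[X])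
    (d : ℕ) : ∃ e, IsSaturatedBound r A d (e + 1) := by
  let ψ : Matrix r q R[X] →ₗ[R] (r → q → Fin (d + 1) → R) :=
    { toFun := fun V i j k => (V i j).coeff k
      map_add' := fun _ _ => by ext; simp
      map_smul' := fun _ _ => by ext; simp }
  have hψ {V W : Matrix r q R[X]} (hV : V ∈ matrixDegreeLT R r q (d + 1))
      (hW : W ∈ matrixDegreeLT R r q (d + 1)) (h : ψ V = ψ W) : V = W := by
    ext i j k
    obtain hk | hk := le_or_gt (d + 1) k
    · rw [mem_matrixDegreeLT.1 hV i j k hk, mem_matrixDegreeLT.1 hW i j k hk]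
    · exact congrFun (congrFun (congrFun h i) j) ⟨k, hk⟩
  let M (e : ℕ) : Submodule R (r → q → Fin (d + 1) → R) :=
    ((matrixDegreeLT R r p e).map (mulRightLinearMap r R A) ⊓
      matrixDegreeLT R r q (d + 1)).map ψ
  have hM : Monotone M := fun a b hab => Submodule.map_mono
    (inf_le_inf_right _ (Submodule.map_mono (matrixDegreeLT_mono hab)))
  obtain ⟨e, he⟩ := monotone_stabilizes_iff_noetherian.2 inferInstance ⟨M, hM⟩
  refine ⟨e, fun V hV hVA => ?_⟩
  have h₁ : (X : R[X]) • (V * A) ∈ matrixDegreeLT R r q (d + 1) := X_smul_mem_matrixDegreeLT hVA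
  have h₂ : ψ ((X : R[X]) • (V * A)) ∈ M (e + 2) := by
    refine Submodule.mem_map_of_mem ⟨⟨(X : R[X]) • V, X_smul_mem_matrixDegreeLT hV, ?_⟩, h₁⟩
    simp
  have h₃ : M (e + 2) = M (e + 1) := (he (e + 2) (by lia)).symm.trans (he (e + 1) (by lia))
  rw [h₃] at h₂
  obtain ⟨_, ⟨⟨W, hW, rfl⟩, hWA⟩, h⟩ := h₂
  exact ⟨W, hW, (hψ hWA h₁ h).symm⟩

variable {A : Matrix p q R[X]} {d e : ℕ}

theorem IsSaturatedBound.exists_sub_mem_span [Finite r] (hA : A ∈ matrixDegreeLT R p q (d + 1))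
    (h : IsSaturatedBound r A d (e + 1)) {V : Matrix r p R[X]}
    (hV : V * A ∈ matrixDegreeLT R r q (d + 1)) :
    ∃ W ∈ matrixDegreeLT R r p (e + 1), V * A = W * A ∧
      V - W ∈ Submodule.span R[X] {Y | Y ∈ matrixDegreeLT R r p (e + 2) ∧ Y * A = 0} := by
  set K := Submodule.span R[X] {Y | Y ∈ matrixDegreeLT R r p (e + 2) ∧ Y * A = 0} with hK
  have hKA {Y : Matrix r p R[X]} (hY : Y ∈ K) : Y * A = 0 := by
    have : K ≤ LinearMap.ker (mulRightLinearMap r R[X] A) :=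
      Submodule.span_le.2 fun Y hY => hY.2
    exact this hY
  have key (J : ℕ) : ∀ (W : ℕ → Matrix r p R[X]) (U : Matrix r p R[X]),
      (∀ j, W j ∈ matrixDegreeLT R r p (e + 1) ∧ W j * A ∈ matrixDegreeLT R r q (d + 1)) →
      (U ∈ matrixDegreeLT R r p (e + 1) ∧ U * A ∈ matrixDegreeLT R r q (d + 1)) →
      (∑ j ∈ Finset.range J, (X ^ j : R[X]) • W j + (X ^ J : R[X]) • U) * A ∈
        matrixDegreeLT R r q (d + 1) →
      ∃ W' ∈ matrixDegreeLT R r p (e + 1),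
        (∑ j ∈ Finset.range J, (X ^ j : R[X]) • W j + (X ^ J : R[X]) • U) - W' ∈ K := by
    induction J with
    | zero => exact fun W U _ hU _ => ⟨U, hU.1, by simp⟩
    | succ J ih =>
      intro W U hW hU hs
      have hlow : (∑ j ∈ Finset.range (J + 1), (X ^ j : R[X]) • W j) * A ∈
          matrixDegreeLT R r q (d + 1 + J) := by
        rw [Matrix.sum_mul]
        refine sum_mem fun j hj => ?_
        rw [Matrix.smul_mul]
        exact matrixDegreeLT_mono (by have := Finset.mem_range.1 hj; lia)
          (X_pow_smul_mem_matrixDegreeLT (hW j).2 j)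
      have hUA : U * A ∈ matrixDegreeLT R r q d := by
        refine mem_matrixDegreeLT.2 fun i j k hk => ?_
        obtain rfl | hk := hk.eq_or_lt
        · have h₁ := mem_matrixDegreeLT.1 hs i j (d + (J + 1)) (by lia)
          rw [Matrix.add_mul, Matrix.add_apply, coeff_add,
            mem_matrixDegreeLT.1 hlow i j _ (by lia), zero_add, Matrix.smul_mul, Matrix.smul_apply,
            smul_eq_mul, coeff_X_pow_mul] at h₁
          exact h₁
        · exact mem_matrixDegreeLT.1 hU.2 i j k hk
      obtain ⟨U', hU', hU'A⟩ := h U hU.1 hUA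
      have hU'd : U' * A ∈ matrixDegreeLT R r q (d + 1) := by
        rw [← hU'A]
        exact X_smul_mem_matrixDegreeLT hUA
      have hY : (X : R[X]) • U - U' ∈ K := Submodule.subset_span
        ⟨sub_mem (X_smul_mem_matrixDegreeLT hU.1) (matrixDegreeLT_mono (by lia) hU'),
          by rw [Matrix.sub_mul, Matrix.smul_mul, hU'A, sub_self]⟩
      have hXY := K.smul_mem (X ^ J : R[X]) hY
      have e₁ : ∑ j ∈ Finset.range (J + 1), (X ^ j : R[X]) • W j + (X ^ (J + 1) : R[X]) • U =
          (∑ j ∈ Finset.range J, (X ^ j : R[X]) • W j + (X ^ J : R[X]) • (W J + U')) +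
            (X ^ J : R[X]) • ((X : R[X]) • U - U') := by
        rw [Finset.sum_range_succ, pow_succ, mul_smul]
        module
      rw [e₁, Matrix.add_mul, hKA hXY, add_zero] at hs
      obtain ⟨W', hW', hW'K⟩ := ih W (W J + U') hW
        ⟨add_mem (hW J).1 hU', by rw [Matrix.add_mul]; exact add_mem (hW J).2 hU'd⟩ hs
      refine ⟨W', hW', ?_⟩
      rw [e₁, add_sub_right_comm]
      exact add_mem hW'K hXY
  obtain ⟨n, hn⟩ := exists_mem_matrixDegreeLT V
  let W (j : ℕ) : Matrix r p R[X] := fun i k => C ((V i k).coeff j)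
  have hW₁ (j : ℕ) : W j ∈ matrixDegreeLT R r p 1 := mem_matrixDegreeLT.2 fun i k m hm => by
    simp only [W, coeff_C]
    rw [if_neg (by lia)]
  have hVW : V = ∑ j ∈ Finset.range (n + 1), (X ^ j : R[X]) • W j + (X ^ (n + 1) : R[X]) • 0 := by
    ext1 i k
    rw [smul_zero, add_zero, Matrix.sum_apply]
    conv_lhs => rw [as_sum_range' (V i k) (n + 1)
      (Nat.lt_succ_of_le (natDegree_le_of_degree_le (mem_degreeLT.1 (hn i k)).le))]
    refine Finset.sum_congr rfl fun j _ => ?_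
    rw [← C_mul_X_pow_eq_monomial, mul_comm]
    rfl
  suffices h : ∃ W ∈ matrixDegreeLT R r p (e + 1), V - W ∈ K by
    obtain ⟨W, hW, hVW⟩ := h
    exact ⟨W, hW, by rw [← sub_eq_zero, ← Matrix.sub_mul, hKA hVW], hVW⟩
  rw [hVW] at hV ⊢
  exact key (n + 1) W 0 (fun j => ⟨matrixDegreeLT_mono (by lia) (hW₁ j),
    mul_mem_matrixDegreeLT (hW₁ j) hA⟩) ⟨zero_mem _, by rw [Matrix.zero_mul]; exact zero_mem _⟩ hV

end BoundedDegree

section Flatten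

open Polynomial

variable {R : Type*} [CommRing R] {r : Type*} {p q E D : ℕ}

/-- The coefficients of degree less than `E` of a matrix of polynomials, as a matrix over the ring of
coefficients. -/
def flattenMatrix (E : ℕ) (V : Matrix r (Fin p) R[X]) : Matrix r (Fin (p * E)) R :=
  fun i k => (V i k.divNat).coeff k.modNat

/-- The matrix of polynomials of degree less than `E` with the given coefficients. -/
noncomputable def unflattenMatrix (E : ℕ) :
    Matrix r (Fin (p * E)) R →ₗ[R] Matrix r (Fin p) R[X] where
  toFun V := Matrix.of fun i j => ∑ s : Fin E, monomial s (V i (finProdFinEquiv (j, s)))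
  map_add' V W := by ext1; simp [Finset.sum_add_distrib]
  map_smul' a V := by ext1; simp [Finset.smul_sum, smul_monomial]

theorem unflattenMatrix_apply (V : Matrix r (Fin (p * E)) R) (i : r) (j : Fin p) :
    unflattenMatrix E V i j = ∑ s : Fin E, monomial (s : ℕ) (V i (finProdFinEquiv (j, s))) :=
  rfl

theorem coeff_unflattenMatrix (V : Matrix r (Fin (p * E)) R) (i : r) (j : Fin p) (s : ℕ) :
    (unflattenMatrix E V i j).coeff s =
      if h : s < E then V i (finProdFinEquiv (j, ⟨s, h⟩)) else 0 := by
  simp only [unflattenMatrix_apply, finsetSum_coeff, coeff_monomial]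
  split_ifs with h
  · rw [Finset.sum_eq_single ⟨s, h⟩] <;> simp +contextual [Fin.ext_iff]
  · exact Finset.sum_eq_zero fun k _ => if_neg (by lia)

theorem unflattenMatrix_mem (V : Matrix r (Fin (p * E)) R) :
    unflattenMatrix E V ∈ matrixDegreeLT R r (Fin p) E :=
  mem_matrixDegreeLT.2 fun i j k hk => by
    rw [coeff_unflattenMatrix, dif_neg (by lia)]

theorem unflattenMatrix_flattenMatrix {V : Matrix r (Fin p) R[X]}
    (hV : V ∈ matrixDegreeLT R r (Fin p) E) : unflattenMatrix E (flattenMatrix E V) = V := by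
  ext i j s
  rw [coeff_unflattenMatrix]
  split_ifs with h
  · have := finProdFinEquiv.symm_apply_apply (j, (⟨s, h⟩ : Fin E))
    simp only [finProdFinEquiv_symm_apply, Prod.mk.injEq] at this
    rw [flattenMatrix, this.1, this.2]
  · exact (mem_matrixDegreeLT.1 hV i j s (by lia)).symm

theorem flattenMatrix_injOn : Set.InjOn (flattenMatrix (R := R) (r := r) (p := p) E)
    (matrixDegreeLT R r (Fin p) E) := fun V hV W hW h => by
  rw [← unflattenMatrix_flattenMatrix hV, h, unflattenMatrix_flattenMatrix hW]

/-- The matrix of the map that multiplies a row vector of polynomials of degree less than `E` by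
`X ^ σ` and by `A` and reads off the coefficients of degrees `o, …, o + D - 1`. -/
noncomputable def toeplitzMatrix (E D σ o : ℕ) (A : Matrix (Fin p) (Fin q) R[X]) :
    Matrix (Fin (p * E)) (Fin (q * D)) R :=
  fun k l => (X ^ ((k.modNat : ℕ) + σ) * A k.divNat l.divNat).coeff (o + l.modNat)

theorem mul_toeplitzMatrix_apply (σ o : ℕ) (A : Matrix (Fin p) (Fin q) R[X])
    (V : Matrix r (Fin (p * E)) R) (i : r) (l : Fin (q * D)) :
    (V * toeplitzMatrix E D σ o A) i l =
      (((X ^ σ : R[X]) • (unflattenMatrix E V * A)) i l.divNat).coeff (o + l.modNat) := by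
  rw [Matrix.smul_apply, Matrix.mul_apply, Matrix.mul_apply, smul_eq_mul, Finset.mul_sum,
    finsetSum_coeff, ← finProdFinEquiv.sum_comp, Fintype.sum_prod_type]
  refine Finset.sum_congr rfl fun j _ => ?_
  rw [unflattenMatrix_apply, Finset.sum_mul, Finset.mul_sum, finsetSum_coeff]
  refine Finset.sum_congr rfl fun s _ => ?_
  have := finProdFinEquiv.symm_apply_apply (j, s)
  simp only [finProdFinEquiv_symm_apply, Prod.mk.injEq] at this
  rw [toeplitzMatrix, this.1, this.2, ← C_mul_X_pow_eq_monomial, ← coeff_C_mul]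
  congr 1
  ring

theorem mul_toeplitzMatrix_zero (σ : ℕ) (A : Matrix (Fin p) (Fin q) R[X])
    (V : Matrix r (Fin (p * E)) R) : V * toeplitzMatrix E D σ 0 A =
      flattenMatrix D ((X ^ σ : R[X]) • (unflattenMatrix E V * A)) := by
  ext i l
  rw [mul_toeplitzMatrix_apply, zero_add]
  rfl

theorem mul_toeplitzMatrix_eq_flattenMatrix_iff {d : ℕ} {A : Matrix (Fin p) (Fin q) R[X]}
    (hA : A ∈ matrixDegreeLT R (Fin p) (Fin q) (d + 1)) (V : Matrix r (Fin (p * E)) R)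
    {B : Matrix r (Fin q) R[X]} (hB : B ∈ matrixDegreeLT R r (Fin q) D) (hD : d + E ≤ D) :
    flattenMatrix D B = V * toeplitzMatrix E D 0 0 A ↔ B = unflattenMatrix E V * A := by
  rw [mul_toeplitzMatrix_zero, pow_zero, one_smul]
  exact flattenMatrix_injOn.eq_iff hB
    (matrixDegreeLT_mono hD (mul_mem_matrixDegreeLT (unflattenMatrix_mem V) hA))

theorem isSaturatedBound_iff {d : ℕ} {A : Matrix (Fin p) (Fin q) R[X]}
    (hA : A ∈ matrixDegreeLT R (Fin p) (Fin q) (d + 1)) (hD : d + E + 1 ≤ D) :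
    IsSaturatedBound r A d E ↔ ∀ V : Matrix r (Fin (p * E)) R,
      V * toeplitzMatrix E D 0 d A = 0 →
        ∃ W : Matrix r (Fin (p * E)) R, V * toeplitzMatrix E D 1 0 A = W * toeplitzMatrix E D 0 0 A := by
  have h₁ (V : Matrix r (Fin (p * E)) R) : V * toeplitzMatrix E D 0 d A = 0 ↔
      unflattenMatrix E V * A ∈ matrixDegreeLT R r (Fin q) d := by
    rw [mem_matrixDegreeLT, ← Matrix.ext_iff]
    simp only [mul_toeplitzMatrix_apply, pow_zero, one_smul, Matrix.zero_apply]
    refine forall_congr' fun i => ⟨fun h j k hk => ?_, fun h l => h _ _ (by lia)⟩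
    obtain hk' | hk' := le_or_gt (d + E) k
    · exact mem_matrixDegreeLT.1 (mul_mem_matrixDegreeLT (unflattenMatrix_mem V) hA) i j k hk'
    · have := h (finProdFinEquiv (j, ⟨k - d, by lia⟩))
      have h' := finProdFinEquiv.symm_apply_apply (j, (⟨k - d, by lia⟩ : Fin D))
      simp only [finProdFinEquiv_symm_apply, Prod.mk.injEq] at h'
      rwa [h'.1, h'.2, Nat.add_sub_cancel' hk] at this
  have h₂ (V W : Matrix r (Fin (p * E)) R) :
      V * toeplitzMatrix E D 1 0 A = W * toeplitzMatrix E D 0 0 A ↔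
        (X : R[X]) • (unflattenMatrix E V * A) = unflattenMatrix E W * A := by
    rw [mul_toeplitzMatrix_zero, pow_one]
    exact mul_toeplitzMatrix_eq_flattenMatrix_iff hA W (matrixDegreeLT_mono hD
      (X_smul_mem_matrixDegreeLT (mul_mem_matrixDegreeLT (unflattenMatrix_mem V) hA))) (by lia)
  simp only [h₁, h₂]
  refine ⟨fun h V hV => ?_, fun h V hV hVA => ?_⟩
  · obtain ⟨W, hW, hWA⟩ := h _ (unflattenMatrix_mem V) hV
    exact ⟨flattenMatrix E W, by rw [unflattenMatrix_flattenMatrix hW, hWA]⟩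
  · obtain ⟨W, hW⟩ := h (flattenMatrix E V) (by rwa [unflattenMatrix_flattenMatrix hV])
    rw [unflattenMatrix_flattenMatrix hV] at hW
    exact ⟨_, unflattenMatrix_mem W, hW⟩

end Flatten

section SolutionSets

variable {R : Type*} [CommRing R] {r p q : ℕ}

/-- `o` describes the solutions of `B = X A`: it is `none` if there are none, and otherwise a
particular solution with generators of the module of solutions of the homogeneous system. -/
def DescribesSolutions (A : Matrix (Fin p) (Fin q) R) (B : Matrix (Fin r) (Fin q) R) :
    Option (Matrix (Fin r) (Fin p) R × List (Matrix (Fin r) (Fin p) R)) → Prop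
  | none => ∀ V : Matrix (Fin r) (Fin p) R, B ≠ V * A
  | some (X₀, L) => B = X₀ * A ∧ ∀ Y, Y ∈ Submodule.span R {Z | Z ∈ L} ↔ Y * A = 0

theorem solutionSet_eq_affineSpan₀_iff {A : Matrix (Fin p) (Fin q) R}
    {B : Matrix (Fin r) (Fin q) R} {X₀ : Matrix (Fin r) (Fin p) R}
    {L : List (Matrix (Fin r) (Fin p) R)} :
    solutionSet A B = affineSpan₀ (R := R) X₀ L ↔
      B = X₀ * A ∧ ∀ Y, Y ∈ Submodule.span R {Z | Z ∈ L} ↔ Y * A = 0 := by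
  refine ⟨fun h => ?_, fun ⟨h₀, h⟩ => ?_⟩
  · have h' (Y : Matrix (Fin r) (Fin p) R) :
        B = (X₀ + Y) * A ↔ Y ∈ Submodule.span R {Z | Z ∈ L} := by
      refine (Set.ext_iff.1 h (X₀ + Y)).trans ⟨?_, fun hY => ⟨Y, hY, rfl⟩⟩
      rintro ⟨Y', hY', e⟩
      rwa [add_left_cancel e]
    have h₀ : B = X₀ * A := by simpa using (h' 0).2 (zero_mem _)
    refine ⟨h₀, fun Y => ?_⟩
    rw [← h' Y, Matrix.add_mul, ← h₀, left_eq_add]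
  · ext V
    refine ⟨fun hV => ⟨V - X₀, (h _).2 ?_, by abel⟩, ?_⟩
    · rw [Matrix.sub_mul, ← h₀, ← (show B = V * A from hV), sub_self]
    · rintro ⟨Y, hY, rfl⟩
      change B = (X₀ + Y) * A
      rw [Matrix.add_mul, ← h₀, (h Y).1 hY, add_zero]

theorem DescribesSolutions.isSome_iff {A : Matrix (Fin p) (Fin q) R}
    {B : Matrix (Fin r) (Fin q) R}
    {o : Option (Matrix (Fin r) (Fin p) R × List (Matrix (Fin r) (Fin p) R))}
    (h : DescribesSolutions A B o) : o.isSome = true ↔ ∃ V : Matrix (Fin r) (Fin p) R, B = V * A := by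
  obtain _ | ⟨X₀, L⟩ := o
  · exact ⟨fun h => (Bool.false_ne_true h).elim, fun ⟨V, hV⟩ => (h V hV).elim⟩
  · exact ⟨fun _ => ⟨X₀, h.1⟩, fun _ => rfl⟩

variable {N : Type*} (ν : N → R)

/-- The answer of an algorithm that solves linear systems, as matrices instead of names. -/
def solutionOfNames (r p : ℕ) (o : Option (List (List N) × List (List (List N)))) :
    Option (Matrix (Fin r) (Fin p) R × List (Matrix (Fin r) (Fin p) R)) :=
  o.map fun y => (matrixOfNames ν r p y.1, y.2.map (matrixOfNames ν r p))

theorem describesSolutions_solutionOfNames_iff {A : Matrix (Fin p) (Fin q) R}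
    {B : Matrix (Fin r) (Fin q) R} {o : Option (List (List N) × List (List (List N)))} :
    DescribesSolutions A B (solutionOfNames ν r p o) ↔
      match o with
      | none => solutionSet A B = ∅
      | some (X₀, L) => solutionSet A B =
          affineSpan₀ (R := R) (matrixOfNames ν r p X₀) (L.map (matrixOfNames ν r p)) := by
  obtain _ | ⟨X₀, L⟩ := o
  · exact Set.eq_empty_iff_forall_notMem.symm
  · exact solutionSet_eq_affineSpan₀_iff.symm

/-- `f` solves all linear systems over the ring presented by `ν`. -/
def IsSolver (f : SystemName N → Option (List (List N) × List (List (List N)))) : Prop :=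
  ∀ (r p q : ℕ) (A B : List (List N)), DescribesSolutions (matrixOfNames ν p q A)
    (matrixOfNames ν r q B) (solutionOfNames ν r p (f ((r, p, q), A, B)))

variable {ν}

theorem IsSolver.isSome_iff {f : SystemName N → Option (List (List N) × List (List (List N)))}
    (hf : IsSolver ν f) (r p q : ℕ) (A B : List (List N)) :
    (f ((r, p, q), A, B)).isSome = true ↔
      ∃ V : Matrix (Fin r) (Fin p) R, matrixOfNames ν r q B = V * matrixOfNames ν p q A := by
  rw [← (hf r p q A B).isSome_iff, solutionOfNames, Option.isSome_map]

theorem isComputableRing_iff [Primcodable N] : IsComputableRing ν ↔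
    HasEffectiveArithmetic ν ∧ ∃ f, Computable f ∧ IsSolver ν f := by
  refine ⟨fun h => ⟨h.1, ?_⟩, fun ⟨h, f, hf, hfs⟩ => ⟨h, f, hf, fun r p q A B => ?_⟩⟩
  · obtain ⟨f, hf, hfs⟩ := h.2
    exact ⟨f, hf, fun r p q A B => (describesSolutions_solutionOfNames_iff ν).2 (hfs r p q A B)⟩
  · exact (describesSolutions_solutionOfNames_iff ν).1 (hfs r p q A B)

end SolutionSets

section MatrixNames

variable {N R : Type*} [CommRing R] {ν : N → R} {z : N}

/-- The name of an entry of the matrix named by `l`, where `z` is a name of `0`. -/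
def nameAt (z : N) (l : List (List N)) (i j : ℕ) : N :=
  ((l[i]?).bind fun row => row[j]?).getD z

theorem matrixOfNames_apply (hz : ν z = 0) (r p : ℕ) (l : List (List N)) (i : Fin r) (j : Fin p) :
    matrixOfNames ν r p l i j = ν (nameAt z l i j) := by
  unfold matrixOfNames nameAt
  cases (l[(i : ℕ)]?).bind fun row => row[(j : ℕ)]? <;> simp [hz]

/-- A name of the `r × p` matrix with entries named by `f`. -/
def matrixName (r p : ℕ) (f : ℕ → ℕ → N) : List (List N) :=
  (List.range r).map fun i => (List.range p).map (f i)

theorem matrixOfNames_matrixName (r p : ℕ) (f : ℕ → ℕ → N) (i : Fin r) (j : Fin p) :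
    matrixOfNames ν r p (matrixName r p f) i j = ν (f i j) := by
  simp [matrixOfNames, matrixName]

@[simp]
theorem matrixOfNames_nil (r p : ℕ) : matrixOfNames ν r p [] = 0 := by
  ext
  simp [matrixOfNames]

/-- A name of the sum of the elements named by the entries of a list. -/
def sumName (z : N) (add : N × N → N) (l : List N) : N :=
  l.foldr (fun a s => add (a, s)) z

theorem map_sumName {add : N × N → N} (hz : ν z = 0)
    (hadd : ∀ x y, ν (add (x, y)) = ν x + ν y) (l : List N) :
    ν (sumName z add l) = (l.map ν).sum := by
  induction l with
  | nil => exact hz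
  | cons a l ih => rw [List.map_cons, List.sum_cons, ← ih, ← hadd]; rfl

theorem map_sumName_range {add : N × N → N} (hz : ν z = 0)
    (hadd : ∀ x y, ν (add (x, y)) = ν x + ν y) (n : ℕ) (f : ℕ → N) :
    ν (sumName z add ((List.range n).map f)) = ∑ k ∈ Finset.range n, ν (f k) := by
  rw [map_sumName hz hadd, List.map_map, ← List.toFinset_range,
    List.sum_toFinset _ List.nodup_range]
  rfl

/-- A name of the product of an `r × p` matrix and a `p × q` matrix. -/
def mulName (z : N) (add mul : N × N → N) (r p q : ℕ) (A B : List (List N)) : List (List N) :=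
  matrixName r q fun i j =>
    sumName z add ((List.range p).map fun k => mul (nameAt z A i k, nameAt z B k j))

theorem matrixOfNames_mulName {add mul : N × N → N} (hz : ν z = 0)
    (hadd : ∀ x y, ν (add (x, y)) = ν x + ν y) (hmul : ∀ x y, ν (mul (x, y)) = ν x * ν y)
    (r p q : ℕ) (A B : List (List N)) :
    matrixOfNames ν r q (mulName z add mul r p q A B) =
      matrixOfNames ν r p A * matrixOfNames ν p q B := by
  ext i j
  rw [mulName, matrixOfNames_matrixName, map_sumName_range hz hadd, Matrix.mul_apply,
    Finset.sum_range]
  simp only [hmul, matrixOfNames_apply hz]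

variable {α : Type*} [Primcodable α] [Primcodable N]

namespace Computable

@[fun_prop]
theorem nameAt {l : α → List (List N)} {i j : α → ℕ} (hl : Computable l) (hi : Computable i)
    (hj : Computable j) : Computable fun a => nameAt z (l a) (i a) (j a) := by
  unfold _root_.nameAt
  fun_prop

@[fun_prop]
theorem matrixName {r p : α → ℕ} {f : α → ℕ → ℕ → N} (hr : Computable r) (hp : Computable p)
    (hf : Computable fun x : α × ℕ × ℕ => f x.1 x.2.1 x.2.2) :
    Computable fun a => matrixName (r a) (p a) (f a) := by
  unfold _root_.matrixName
  refine list_map (by fun_prop) (list_map (by fun_prop) ?_)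
  exact hf.comp (g := fun x : (α × ℕ) × ℕ => (x.1.1, x.1.2, x.2)) (by fun_prop)

@[fun_prop]
theorem sumName {add : N × N → N} (hadd : Computable add) {l : α → List N} (hl : Computable l) :
    Computable fun a => sumName z add (l a) := by
  unfold _root_.sumName
  fun_prop

@[fun_prop]
theorem mulName {add mul : N × N → N} (hadd : Computable add) (hmul : Computable mul)
    {r p q : α → ℕ} {A B : α → List (List N)} (hr : Computable r) (hp : Computable p)
    (hq : Computable q) (hA : Computable A) (hB : Computable B) :
    Computable fun a => mulName z add mul (r a) (p a) (q a) (A a) (B a) := by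
  unfold _root_.mulName
  fun_prop

end Computable

end MatrixNames

section UnivariateNames

open Polynomial

variable {N R : Type*} [CommRing R] {ν : N → R} {z : N}

/-- The polynomial with the coefficients named by the entries of a list. -/
noncomputable def polynomialOfList (ν : N → R) (l : List N) : R[X] :=
  l.foldr (fun a P => C (ν a) + X * P) 0

theorem coeff_polynomialOfList (hz : ν z = 0) (l : List N) (i : ℕ) :
    (polynomialOfList ν l).coeff i = ν (l.getD i z) := by
  induction l generalizing i with
  | nil => simp [polynomialOfList, hz]
  | cons a l ih =>
    change (C (ν a) + X * polynomialOfList ν l).coeff i = _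
    cases i with
    | zero => simp
    | succ i => simpa [coeff_C] using ih i

theorem polynomialOfList_mem_degreeLT (hz : ν z = 0) (l : List N) :
    polynomialOfList ν l ∈ degreeLT R l.length :=
  mem_degreeLT_iff_coeff.2 fun k hk => by
    rw [coeff_polynomialOfList hz, List.getD_eq_default _ _ hk, hz]

theorem polynomialOfList_map_range (hz : ν z = 0) (n : ℕ) (f : ℕ → N) (i : ℕ) :
    (polynomialOfList ν ((List.range n).map f)).coeff i = if i < n then ν (f i) else 0 := by
  rw [coeff_polynomialOfList hz, List.getD_eq_getElem?_getD, List.getElem?_map]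
  split_ifs with h <;> simp [h, hz]

theorem polynomialOfList_surjective (hν : Function.Surjective ν) :
    Function.Surjective (polynomialOfList ν) := by
  obtain ⟨z, hz⟩ := hν 0
  intro P
  choose g hg using hν
  refine ⟨(List.range (P.natDegree + 1)).map fun i => g (P.coeff i), ?_⟩
  ext i
  rw [polynomialOfList_map_range hz, hg]
  split_ifs with h
  · rfl
  · exact (coeff_eq_zero_of_natDegree_lt (by lia)).symm

theorem HasEffectiveArithmetic.polynomialOfList [Primcodable N] (h : HasEffectiveArithmetic ν) :
    HasEffectiveArithmetic (polynomialOfList ν) := by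
  obtain ⟨z, hz⟩ := h.surjective 0
  obtain ⟨add, hadd, add_spec⟩ := h.add
  obtain ⟨neg, hneg, neg_spec⟩ := h.neg
  obtain ⟨mul, hmul, mul_spec⟩ := h.mul
  obtain ⟨eq, heq, eq_spec⟩ := ComputablePred.computable_iff.1 h.decidable_eq
  have eq_iff (a b : N) : eq (a, b) = true ↔ ν a = ν b :=
    Iff.of_eq (congrFun eq_spec (a, b)).symm
  have coeff_zero {l : List N} {i : ℕ} (hi : l.length ≤ i) : ν (l.getD i z) = 0 := by
    rw [List.getD_eq_default _ _ hi, hz]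
  refine ⟨polynomialOfList_surjective h.surjective, ?_, ?_, ?_, ?_⟩
  · refine ComputablePred.computable_iff.2 ⟨fun x => (List.range (max x.1.length x.2.length)).all
      fun i => eq (x.1.getD i z, x.2.getD i z), by fun_prop, ?_⟩
    funext x
    simp only [List.all_eq_true, List.mem_range, eq_iff, eq_iff_iff, Polynomial.ext_iff,
      coeff_polynomialOfList hz]
    refine ⟨fun h i _ => h i, fun h i => ?_⟩
    obtain hi | hi := lt_or_ge i (max x.1.length x.2.length)
    · exact h i hi
    · rw [coeff_zero (le_trans (le_max_left _ _) hi), coeff_zero (le_trans (le_max_right _ _) hi)]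
  · refine ⟨fun x => (List.range (max x.1.length x.2.length)).map
      fun i => add (x.1.getD i z, x.2.getD i z), by fun_prop, fun x y => ?_⟩
    ext i
    rw [polynomialOfList_map_range hz, coeff_add, coeff_polynomialOfList hz,
      coeff_polynomialOfList hz, add_spec]
    split_ifs with hi
    · rfl
    · rw [coeff_zero (le_trans (le_max_left _ _) (not_lt.1 hi)),
        coeff_zero (le_trans (le_max_right _ _) (not_lt.1 hi)), add_zero]
  · refine ⟨fun x => x.map neg, by fun_prop, fun x => ?_⟩
    induction x with
    | nil => simp [_root_.polynomialOfList]
    | cons a l ih =>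
      change C (ν (neg a)) + X * _root_.polynomialOfList ν (l.map neg) =
        -(C (ν a) + X * _root_.polynomialOfList ν l)
      rw [ih, neg_spec, C_neg]
      ring
  · refine ⟨fun x => (List.range (x.1.length + x.2.length)).map fun k => sumName z add
      ((List.range (k + 1)).map fun i => mul (x.1.getD i z, x.2.getD (k - i) z)), by fun_prop,
      fun x y => ?_⟩
    ext k
    rw [polynomialOfList_map_range hz, coeff_mul,
      Finset.Nat.sum_antidiagonal_eq_sum_range_succ_mk, map_sumName_range hz add_spec]
    simp only [mul_spec, coeff_polynomialOfList hz]
    split_ifs with hk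
    · rfl
    · refine (Finset.sum_eq_zero fun i hi => ?_).symm
      obtain hx | hx := le_or_gt x.length i
      · rw [coeff_zero hx, zero_mul]
      · rw [coeff_zero (l := y) (by lia), mul_zero]

end UnivariateNames

section UnivariateSolver

open Polynomial

variable {N R : Type*} [CommRing R] {ν : N → R} {z : N}

/-- The name of a coefficient of an entry of a matrix of polynomials, where `z` is a name of `0`. -/
def coeffAt (z : N) (A : List (List (List N))) (i j t : ℕ) : N :=
  (nameAt [] A i j).getD t z

theorem coeff_matrixOfNames (hz : ν z = 0) (r p : ℕ) (A : List (List (List N))) (i : Fin r)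
    (j : Fin p) (t : ℕ) : (matrixOfNames (polynomialOfList ν) r p A i j).coeff t =
      ν (coeffAt z A i j t) := by
  rw [matrixOfNames_apply (z := []) rfl, coeff_polynomialOfList hz]
  rfl

/-- A bound for the degrees of the entries of a matrix of polynomials. -/
def lengthBound (A : List (List (List N))) : ℕ :=
  (A.map fun row => (row.map List.length).sum).sum

theorem length_nameAt_le (A : List (List (List N))) (i j : ℕ) :
    (nameAt [] A i j).length ≤ lengthBound A := by
  unfold nameAt
  cases hi : A[i]? with
  | none => simp
  | some row =>
    cases hj : row[j]? with
    | none => simp [hj]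
    | some l =>
      simp only [Option.bind_some, hj, Option.getD_some]
      exact (List.le_sum_of_mem (List.mem_map_of_mem (List.mem_of_getElem? hj))).trans
        (List.le_sum_of_mem (List.mem_map_of_mem (f := fun row => (row.map List.length).sum)
          (List.mem_of_getElem? hi)))

theorem matrixOfNames_mem_matrixDegreeLT (hz : ν z = 0) (r p : ℕ) (A : List (List (List N))) :
    matrixOfNames (polynomialOfList ν) r p A ∈
      matrixDegreeLT R (Fin r) (Fin p) (lengthBound A) := fun i j => by
  rw [matrixOfNames_apply (z := []) rfl]
  exact degreeLT_mono (length_nameAt_le A i j) (polynomialOfList_mem_degreeLT hz _)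

/-- A name of a Toeplitz matrix. -/
def toeplitzName (z : N) (p q E D σ o : ℕ) (A : List (List (List N))) : List (List N) :=
  matrixName (p * E) (q * D) fun k l => bif decide (k % E + σ ≤ o + l % D) then
    coeffAt z A (k / E) (l / D) (o + l % D - (k % E + σ)) else z

theorem matrixOfNames_toeplitzName (hz : ν z = 0) (p q E D σ o : ℕ) (A : List (List (List N))) :
    matrixOfNames ν (p * E) (q * D) (toeplitzName z p q E D σ o A) =
      toeplitzMatrix E D σ o (matrixOfNames (polynomialOfList ν) p q A) := by
  ext k l
  rw [toeplitzName, matrixOfNames_matrixName, toeplitzMatrix, coeff_X_pow_mul',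
    coeff_matrixOfNames hz]
  by_cases h : (k : ℕ) % E + σ ≤ o + (l : ℕ) % D
  · rw [decide_eq_true h, cond_true, if_pos (by exact h)]
    rfl
  · rw [decide_eq_false h, cond_false, hz, if_neg (by exact h)]

/-- A name of the matrix of coefficients of degree less than `D`. -/
def flattenName (z : N) (r q D : ℕ) (B : List (List (List N))) : List (List N) :=
  matrixName r (q * D) fun i l => coeffAt z B i (l / D) (l % D)

theorem matrixOfNames_flattenName (hz : ν z = 0) (r q D : ℕ) (B : List (List (List N))) :
    matrixOfNames ν r (q * D) (flattenName z r q D B) =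
      flattenMatrix D (matrixOfNames (polynomialOfList ν) r q B) := by
  ext i l
  rw [flattenName, matrixOfNames_matrixName, flattenMatrix, coeff_matrixOfNames hz]
  rfl

/-- A name of the matrix of polynomials of degree less than `E` with the given coefficients. -/
def unflattenName (z : N) (r p E : ℕ) (V : List (List N)) : List (List (List N)) :=
  matrixName r p fun i j => (List.range E).map fun s => nameAt z V i (s + E * j)

theorem matrixOfNames_unflattenName (hz : ν z = 0) (r p E : ℕ) (V : List (List N)) :
    matrixOfNames (polynomialOfList ν) r p (unflattenName z r p E V) =
      unflattenMatrix E (matrixOfNames ν r (p * E) V) := by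
  ext i j s
  rw [unflattenName, matrixOfNames_matrixName, polynomialOfList_map_range hz,
    coeff_unflattenMatrix]
  split_ifs with h
  · rw [matrixOfNames_apply hz]
    rfl
  · rfl

variable (z) (add mul : N × N → N)
  (f : SystemName N → Option (List (List N) × List (List (List N))))

/-- A bound for the degrees of the entries of the matrices of a linear system. -/
def systemDegree (x : SystemName (List N)) : ℕ := lengthBound x.2.1 + lengthBound x.2.2

/-- The test whether `e + 1` is a saturated bound for a linear system over the polynomial ring,
where `f` solves linear systems over the ring of coefficients. -/
def saturationTest (x : SystemName (List N)) (e : ℕ) : Bool :=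
  let d := systemDegree x
  let r := x.1.1
  let P := x.1.2.1 * (e + 1)
  let Q := x.1.2.2 * (d + e + 2)
  let T := fun σ o => toeplitzName z x.1.2.1 x.1.2.2 (e + 1) (d + e + 2) σ o x.2.1
  (f ((r, P, Q), T 0 d, [])).elim false fun y => y.2.all fun V =>
    (f ((r, P, Q), T 0 0, mulName z add mul r P Q V (T 1 0))).isSome

/-- The solution of a linear system over the polynomial ring by polynomials of degree at most
`e + 1`. -/
def boundedSolution (x : SystemName (List N)) (e : ℕ) :
    Option (List (List (List N)) × List (List (List (List N)))) :=
  let d := systemDegree x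
  (f ((x.1.1, x.1.2.1 * (e + 2), x.1.2.2 * (d + e + 2)),
    toeplitzName z x.1.2.1 x.1.2.2 (e + 2) (d + e + 2) 0 0 x.2.1,
    flattenName z x.1.1 x.1.2.2 (d + e + 2) x.2.2)).map fun y =>
      (unflattenName z x.1.1 x.1.2.1 (e + 2) y.1, y.2.map (unflattenName z x.1.1 x.1.2.1 (e + 2)))

variable {z add mul f}

theorem saturationTest_iff (hz : ν z = 0) (hadd : ∀ x y, ν (add (x, y)) = ν x + ν y)
    (hmul : ∀ x y, ν (mul (x, y)) = ν x * ν y) (hf : IsSolver ν f) (r p q : ℕ)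
    (A B : List (List (List N))) (e : ℕ) :
    saturationTest z add mul f ((r, p, q), A, B) e = true ↔
      IsSaturatedBound (Fin r) (matrixOfNames (polynomialOfList ν) p q A)
        (systemDegree ((r, p, q), A, B)) (e + 1) := by
  set d := systemDegree ((r, p, q), A, B) with hd
  have hA : matrixOfNames (polynomialOfList ν) p q A ∈
      matrixDegreeLT R (Fin p) (Fin q) (d + 1) :=
    matrixDegreeLT_mono (by rw [hd]; simp only [systemDegree]; lia)
      (matrixOfNames_mem_matrixDegreeLT hz p q A)
  rw [isSaturatedBound_iff (D := d + e + 2) hA (by lia)]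
  simp only [saturationTest, ← hd]
  have hs := hf r (p * (e + 1)) (q * (d + e + 2)) (toeplitzName z p q (e + 1) (d + e + 2) 0 d A) []
  rw [matrixOfNames_toeplitzName hz, matrixOfNames_nil] at hs
  generalize f ((r, p * (e + 1), q * (d + e + 2)), toeplitzName z p q (e + 1) (d + e + 2) 0 d A, [])
    = o at hs ⊢
  obtain _ | ⟨X₀, L⟩ := o
  · exact (hs 0 (by rw [Matrix.zero_mul])).elim
  · obtain ⟨-, hL⟩ := hs
    simp only [Option.elim_some, List.all_eq_true, hf.isSome_iff, matrixOfNames_toeplitzName hz,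
      matrixOfNames_mulName hz hadd hmul]
    simp only [← hL]
    refine ⟨fun h V hV => ?_, fun h V hV =>
      h _ (Submodule.subset_span (List.mem_map_of_mem hV))⟩
    have hle : Submodule.span R {Z | Z ∈ L.map (matrixOfNames ν r (p * (e + 1)))} ≤
        (LinearMap.range (mulRightLinearMap (Fin r) R (toeplitzMatrix (e + 1) (d + e + 2) 0 0
          (matrixOfNames (polynomialOfList ν) p q A)))).comap
        (mulRightLinearMap (Fin r) R (toeplitzMatrix (e + 1) (d + e + 2) 1 0
          (matrixOfNames (polynomialOfList ν) p q A))) := by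
      refine Submodule.span_le.2 fun Y hY => ?_
      obtain ⟨V, hV, rfl⟩ := List.mem_map.1 hY
      obtain ⟨W, hW⟩ := h V hV
      exact ⟨W, hW.symm⟩
    obtain ⟨W, hW⟩ := hle hV
    exact ⟨W, hW.symm⟩

theorem describesSolutions_boundedSolution (hz : ν z = 0) (hf : IsSolver ν f) {r p q : ℕ}
    {A B : List (List (List N))} {e : ℕ}
    (he : IsSaturatedBound (Fin r) (matrixOfNames (polynomialOfList ν) p q A)
      (systemDegree ((r, p, q), A, B)) (e + 1)) :
    DescribesSolutions (matrixOfNames (polynomialOfList ν) p q A)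
      (matrixOfNames (polynomialOfList ν) r q B)
      (solutionOfNames (polynomialOfList ν) r p (boundedSolution z f ((r, p, q), A, B) e)) := by
  set d := systemDegree ((r, p, q), A, B) with hd
  have hdef : d = lengthBound A + lengthBound B := rfl
  have hA : matrixOfNames (polynomialOfList ν) p q A ∈
      matrixDegreeLT R (Fin p) (Fin q) (d + 1) :=
    matrixDegreeLT_mono (by lia) (matrixOfNames_mem_matrixDegreeLT hz p q A)
  have hB : matrixOfNames (polynomialOfList ν) r q B ∈
      matrixDegreeLT R (Fin r) (Fin q) (d + 1) :=
    matrixDegreeLT_mono (by lia) (matrixOfNames_mem_matrixDegreeLT hz r q B)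
  have hs := hf r (p * (e + 2)) (q * (d + e + 2)) (toeplitzName z p q (e + 2) (d + e + 2) 0 0 A)
    (flattenName z r q (d + e + 2) B)
  rw [matrixOfNames_toeplitzName hz, matrixOfNames_flattenName hz] at hs
  simp only [boundedSolution, ← hd]
  generalize f ((r, p * (e + 2), q * (d + e + 2)), toeplitzName z p q (e + 2) (d + e + 2) 0 0 A,
    flattenName z r q (d + e + 2) B) = o at hs ⊢
  generalize matrixOfNames (polynomialOfList ν) p q A = A' at *
  generalize matrixOfNames (polynomialOfList ν) r q B = B' at *
  have key := mul_toeplitzMatrix_eq_flattenMatrix_iff (r := Fin r) (E := e + 2) (D := d + e + 2) hA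
  have key₀ (V : Matrix (Fin r) (Fin (p * (e + 2))) R) :
      V * toeplitzMatrix (e + 2) (d + e + 2) 0 0 A' = 0 ↔ unflattenMatrix (e + 2) V * A' = 0 := by
    rw [eq_comm, eq_comm (b := 0), ← key V (zero_mem _) (by lia)]
    rfl
  obtain _ | ⟨V₀, L⟩ := o
  · rintro V rfl
    obtain ⟨W, hW, hVW, -⟩ := he.exists_sub_mem_span hA hB
    refine hs (flattenMatrix (e + 2) W) ((key _ (matrixDegreeLT_mono (by lia) hB) (by lia)).2 ?_)
    rw [unflattenMatrix_flattenMatrix (matrixDegreeLT_mono (by lia) hW), hVW]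
  · obtain ⟨h₀, hL⟩ := hs
    simp only [solutionOfNames, Option.map_some, List.map_map, DescribesSolutions]
    rw [matrixOfNames_unflattenName hz]
    refine ⟨(key _ (matrixDegreeLT_mono (by lia) hB) (by lia)).1 h₀, fun Y => ⟨fun hY => ?_,
      fun hY => ?_⟩⟩
    · have : Submodule.span R[X] {Z | Z ∈ L.map (matrixOfNames (polynomialOfList ν) r p ∘
          unflattenName z r p (e + 2))} ≤ LinearMap.ker (mulRightLinearMap (Fin r) R[X] A') := by
        refine Submodule.span_le.2 fun Z hZ => ?_
        obtain ⟨V, hV, rfl⟩ := List.mem_map.1 hZ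
        rw [Function.comp_apply, matrixOfNames_unflattenName hz]
        exact (key₀ _).1 ((hL _).1 (Submodule.subset_span (List.mem_map_of_mem hV)))
      exact this hY
    · obtain ⟨W, hW, hYW, hsub⟩ := he.exists_sub_mem_span (V := Y) hA
        (by rw [hY]; exact zero_mem _)
      suffices h : ∀ Z ∈ matrixDegreeLT R (Fin r) (Fin p) (e + 2), Z * A' = 0 →
          Z ∈ Submodule.span R[X] {Z | Z ∈ L.map (matrixOfNames (polynomialOfList ν) r p ∘
            unflattenName z r p (e + 2))} by
        rw [← sub_add_cancel Y W]
        exact add_mem (Submodule.span_le.2 (fun Z hZ => h Z hZ.1 hZ.2) hsub)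
          (h W (matrixDegreeLT_mono (by lia) hW) (by rw [← hYW, hY]))
      intro Z hZ hZA
      have hZL := (hL (flattenMatrix (e + 2) Z)).2
        ((key₀ _).2 (by rw [unflattenMatrix_flattenMatrix hZ, hZA]))
      have := Submodule.mem_map_of_mem (f := unflattenMatrix (e + 2)) hZL
      rw [unflattenMatrix_flattenMatrix hZ, Submodule.map_span] at this
      refine Submodule.span_subset_span R R[X] _ (Submodule.span_mono ?_ this)
      rintro _ ⟨_, hY, rfl⟩
      obtain ⟨V, hV, rfl⟩ := List.mem_map.1 hY
      exact List.mem_map.2 ⟨V, hV, matrixOfNames_unflattenName hz _ _ _ _⟩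

variable {α : Type*} [Primcodable α] [Primcodable N]

namespace Computable

@[fun_prop]
theorem coeffAt {A : α → List (List (List N))} {i j t : α → ℕ} (hA : Computable A)
    (hi : Computable i) (hj : Computable j) (ht : Computable t) :
    Computable fun a => coeffAt z (A a) (i a) (j a) (t a) := by
  unfold _root_.coeffAt
  fun_prop

@[fun_prop]
theorem lengthBound {A : α → List (List (List N))} (hA : Computable A) :
    Computable fun a => lengthBound (A a) := by
  unfold _root_.lengthBound
  fun_prop

@[fun_prop]
theorem toeplitzName {p q E D σ o : α → ℕ} {A : α → List (List (List N))} (hp : Computable p)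
    (hq : Computable q) (hE : Computable E) (hD : Computable D) (hσ : Computable σ)
    (ho : Computable o) (hA : Computable A) :
    Computable fun a => toeplitzName z (p a) (q a) (E a) (D a) (σ a) (o a) (A a) := by
  unfold _root_.toeplitzName
  fun_prop

@[fun_prop]
theorem flattenName {r q D : α → ℕ} {B : α → List (List (List N))} (hr : Computable r)
    (hq : Computable q) (hD : Computable D) (hB : Computable B) :
    Computable fun a => flattenName z (r a) (q a) (D a) (B a) := by
  unfold _root_.flattenName
  fun_prop

@[fun_prop]
theorem unflattenName {r p E : α → ℕ} {V : α → List (List N)} (hr : Computable r)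
    (hp : Computable p) (hE : Computable E) (hV : Computable V) :
    Computable fun a => unflattenName z (r a) (p a) (E a) (V a) := by
  unfold _root_.unflattenName
  fun_prop

theorem saturationTest (hadd : Computable add) (hmul : Computable mul) (hf : Computable f) :
    Computable fun x : SystemName (List N) × ℕ => saturationTest z add mul f x.1 x.2 := by
  unfold _root_.saturationTest systemDegree
  dsimp only
  fun_prop

theorem boundedSolution (hf : Computable f) :
    Computable fun x : SystemName (List N) × ℕ => boundedSolution z f x.1 x.2 := by
  unfold _root_.boundedSolution systemDegree
  dsimp only
  fun_prop

end Computable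

theorem IsComputableRing.polynomialOfList [IsNoetherianRing R] (h : IsComputableRing ν) :
    IsComputableRing (polynomialOfList ν) := by
  obtain ⟨h, f, hf, hfs⟩ := isComputableRing_iff.1 h
  obtain ⟨z, hz⟩ := h.surjective 0
  obtain ⟨add, hadd, add_spec⟩ := h.add
  obtain ⟨mul, hmul, mul_spec⟩ := h.mul
  have hex (x : SystemName (List N)) : ∃ e, saturationTest z add mul f x e = true := by
    obtain ⟨e, he⟩ := exists_isSaturatedBound (r := Fin x.1.1)
      (matrixOfNames (_root_.polynomialOfList ν) x.1.2.1 x.1.2.2 x.2.1) (systemDegree x)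
    exact ⟨e, (saturationTest_iff hz add_spec mul_spec hfs _ _ _ _ _ e).2 he⟩
  obtain ⟨e, he, he_spec⟩ :=
    Computable.exists_nat_search (Computable.saturationTest hadd hmul hf) hex
  refine isComputableRing_iff.2 ⟨h.polynomialOfList, fun x => boundedSolution z f x (e x),
    Computable.comp (f := fun y : SystemName (List N) × ℕ => boundedSolution z f y.1 y.2)
      (g := fun x => (x, e x)) (Computable.boundedSolution hf) (Computable.id.pair he),
    fun r p q A B => ?_⟩
  exact describesSolutions_boundedSolution hz hfs
    ((saturationTest_iff hz add_spec mul_spec hfs _ _ _ _ _ _).1 (he_spec _).1)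

end UnivariateSolver

section Transfer

variable {N N' R R' : Type*} [CommRing R] [CommRing R'] {ν : N → R} {ν' : N' → R'}

theorem DescribesSolutions.map {r p q : ℕ} {A : Matrix (Fin p) (Fin q) R}
    {B : Matrix (Fin r) (Fin q) R}
    {o : Option (Matrix (Fin r) (Fin p) R × List (Matrix (Fin r) (Fin p) R))}
    (h : DescribesSolutions A B o) (e : R ≃+* R') : DescribesSolutions (A.map e) (B.map e)
      (o.map fun y => (y.1.map e, y.2.map fun Z => Z.map e)) := by
  have hmul (V : Matrix (Fin r) (Fin p) R) : (V * A).map e = V.map e * A.map e :=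
    Matrix.map_mul
  have hinj {m n : Type _} : Function.Injective fun V : Matrix m n R => V.map e :=
    Matrix.map_injective e.injective
  have hinv (V : Matrix (Fin r) (Fin p) R') : (V.map e.symm).map e = V := by ext; simp
  obtain _ | ⟨X₀, L⟩ := o
  · intro V hV
    rw [← hinv V, ← hmul] at hV
    exact h _ (hinj hV)
  · refine ⟨by rw [h.1]; exact hmul _, fun Y => ⟨fun hY => ?_, fun hY => ?_⟩⟩
    · have hle : Submodule.span R' {Z | Z ∈ L.map fun Z => Z.map e} ≤
          LinearMap.ker (mulRightLinearMap (Fin r) R' (A.map e)) := by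
        refine Submodule.span_le.2 fun Z hZ => ?_
        obtain ⟨W, hW, rfl⟩ := List.mem_map.1 hZ
        change W.map e * A.map e = 0
        rw [← hmul, (h.2 W).1 (Submodule.subset_span hW), Matrix.map_zero _ (map_zero e)]
      exact hle hY
    · have hY' : Y.map e.symm ∈ Submodule.span R {Z | Z ∈ L} := by
        refine (h.2 _).2 (hinj ?_)
        simp only
        rw [hmul, hinv, hY, Matrix.map_zero _ (map_zero e)]
      rw [← hinv Y]
      generalize Y.map e.symm = Y' at hY'
      induction hY' using Submodule.span_induction with
      | mem Z hZ =>
        exact Submodule.subset_span (List.mem_map_of_mem (f := fun Z => Z.map e) hZ)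
      | zero => rw [Matrix.map_zero _ (map_zero e)]; exact zero_mem _
      | add Z W _ _ hZ hW => rw [Matrix.map_add _ (map_add e)]; exact add_mem hZ hW
      | smul a Z _ hZ =>
        rw [show (a • Z).map e = e a • Z.map e by ext; simp]
        exact Submodule.smul_mem _ _ hZ

theorem matrixOfNames_comp (ν : N → R) (e : R ≃+* R') (r p : ℕ) (l : List (List N)) :
    matrixOfNames (e ∘ ν) r p l = (matrixOfNames ν r p l).map e := by
  ext i j
  simp only [matrixOfNames, Matrix.map_apply]
  cases (l[(i : ℕ)]?).bind fun row => row[(j : ℕ)]? <;> simp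

theorem matrixOfNames_map (ν : N → R) (φ : N' → N) (r p : ℕ) (l : List (List N')) :
    matrixOfNames ν r p (l.map (List.map φ)) = matrixOfNames (ν ∘ φ) r p l := by
  ext i j
  simp only [matrixOfNames, List.getElem?_map]
  cases l[(i : ℕ)]? with
  | none => rfl
  | some row =>
    simp only [Option.map_some, Option.bind_some, List.getElem?_map]
    cases row[(j : ℕ)]? <;> rfl

variable [Primcodable N] [Primcodable N']

theorem HasEffectiveArithmetic.transfer (h : HasEffectiveArithmetic ν) (e : R ≃+* R')
    {φ : N' → N} {ψ : N → N'} (hφ : Computable φ) (hψ : Computable ψ)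
    (hφe : ∀ x, e (ν (φ x)) = ν' x) (hψe : ∀ y, ν' (ψ y) = e (ν y)) :
    HasEffectiveArithmetic ν' := by
  obtain ⟨add, hadd, add_spec⟩ := h.add
  obtain ⟨neg, hneg, neg_spec⟩ := h.neg
  obtain ⟨mul, hmul, mul_spec⟩ := h.mul
  obtain ⟨eq, heq, eq_spec⟩ := ComputablePred.computable_iff.1 h.decidable_eq
  refine ⟨fun P => ?_, ComputablePred.computable_iff.2 ⟨fun x => eq (φ x.1, φ x.2), by fun_prop, ?_⟩,
    ⟨fun x => ψ (add (φ x.1, φ x.2)), by fun_prop, fun x y => ?_⟩,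
    ⟨fun x => ψ (neg (φ x)), by fun_prop, fun x => ?_⟩,
    ⟨fun x => ψ (mul (φ x.1, φ x.2)), by fun_prop, fun x y => ?_⟩⟩
  · obtain ⟨y, hy⟩ := h.surjective (e.symm P)
    exact ⟨ψ y, by rw [hψe, hy, e.apply_symm_apply]⟩
  · funext x
    rw [← congrFun eq_spec (φ x.1, φ x.2), ← hφe, ← hφe, e.injective.eq_iff]
  · rw [hψe, add_spec, map_add, hφe, hφe]
  · rw [hψe, neg_spec, map_neg, hφe]
  · rw [hψe, mul_spec, map_mul, hφe, hφe]

theorem IsComputableRing.transfer (h : IsComputableRing ν) (e : R ≃+* R')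
    {φ : N' → N} {ψ : N → N'} (hφ : Computable φ) (hψ : Computable ψ)
    (hφe : ∀ x, e (ν (φ x)) = ν' x) (hψe : ∀ y, ν' (ψ y) = e (ν y)) :
    IsComputableRing ν' := by
  obtain ⟨ha, f, hf, hfs⟩ := isComputableRing_iff.1 h
  refine isComputableRing_iff.2 ⟨ha.transfer e hφ hψ hφe hψe, fun x =>
    (f (x.1, x.2.1.map (List.map φ), x.2.2.map (List.map φ))).map fun y =>
      (y.1.map (List.map ψ), y.2.map (List.map (List.map ψ))), by fun_prop, fun r p q A B => ?_⟩
  have hν' : e ∘ ν ∘ φ = ν' := funext hφe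
  have hν : ν' ∘ ψ = e ∘ ν := funext hψe
  have key := (hfs r p q (A.map (List.map φ)) (B.map (List.map φ))).map e
  simp only [matrixOfNames_map, ← matrixOfNames_comp, hν'] at key
  convert key using 1
  simp only [solutionOfNames, Option.map_map]
  congr 1
  funext y
  simp only [Function.comp_apply, matrixOfNames_map, hν, ← matrixOfNames_comp, List.map_map]
  refine Prod.ext rfl (List.map_congr_left fun Z _ => ?_)
  simp only [Function.comp_apply, matrixOfNames_map, hν, ← matrixOfNames_comp]

end Transfer

section MultivariateNames

variable {N B : Type*} [CommRing B]

/-- The exponent vector with `k` entries described by a list. -/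
noncomputable def exponentVector (k : ℕ) (e : List ℕ) : Fin k →₀ ℕ :=
  Finsupp.equivFunOnFinite.symm fun i => e.getD i 0

/-- The polynomial in `k` variables named by a list of terms. -/
noncomputable def mvPolynomialOfTerms (ν : N → B) (k : ℕ) (l : List (N × List ℕ)) :
    MvPolynomial (Fin k) B :=
  (l.map fun t => MvPolynomial.monomial (exponentVector k t.2) (ν t.1)).sum

theorem exponentVector_succ (k : ℕ) (e : List ℕ) :
    exponentVector (k + 1) e = (exponentVector k e.tail).cons (e.getD 0 0) := by
  ext i
  refine Fin.cases ?_ (fun i => ?_) i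
  · simp [exponentVector]
  · cases e <;> simp [exponentVector]

theorem finSuccEquiv_monomial_exponentVector (k : ℕ) (e : List ℕ) (b : B) :
    MvPolynomial.finSuccEquiv B k (MvPolynomial.monomial (exponentVector (k + 1) e) b) =
      Polynomial.monomial (e.getD 0 0) (MvPolynomial.monomial (exponentVector k e.tail) b) := by
  ext i m
  rw [MvPolynomial.finSuccEquiv_coeff_coeff, exponentVector_succ, MvPolynomial.coeff_monomial,
    Polynomial.coeff_monomial]
  have hcons : (exponentVector k e.tail).cons (e.getD 0 0) = m.cons i ↔
      e.getD 0 0 = i ∧ exponentVector k e.tail = m :=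
    ⟨fun h => ⟨by simpa only [Finsupp.cons_zero] using DFunLike.congr_fun h 0,
      by simpa only [Finsupp.tail_cons] using congrArg Finsupp.tail h⟩, fun h => by rw [h.1, h.2]⟩
  simp only [hcons]
  split_ifs with h₁ h₂ h₂ <;> simp_all

variable (ν : N → B)

theorem mvPolynomialOfTerms_flatMap {α : Type*} (k : ℕ) (l : List α) (f : α → List (N × List ℕ)) :
    mvPolynomialOfTerms ν k (l.flatMap f) = (l.map fun a => mvPolynomialOfTerms ν k (f a)).sum := by
  induction l with
  | nil => rfl
  | cons a l ih =>
    rw [List.flatMap_cons, List.map_cons, List.sum_cons, ← ih]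
    simp [mvPolynomialOfTerms]

/-- The coefficients, as polynomials in the other variables, of a polynomial in `k + 1` variables
with respect to the first one. -/
def toUnivariate (l : List (N × List ℕ)) : List (List (N × List ℕ)) :=
  (List.range (l.map fun t => t.2.getD 0 0 + 1).sum).map fun i =>
    (l.filter fun t => decide (t.2.getD 0 0 = i)).map fun t => (t.1, t.2.tail)

/-- The inverse of `toUnivariate` on names. -/
def ofUnivariate (l : List (List (N × List ℕ))) : List (N × List ℕ) :=
  (List.range l.length).flatMap fun i => (l.getD i []).map fun t => (t.1, i :: t.2)

theorem polynomialOfList_toUnivariate (k : ℕ) (l : List (N × List ℕ)) :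
    polynomialOfList (mvPolynomialOfTerms ν k) (toUnivariate l) =
      MvPolynomial.finSuccEquiv B k (mvPolynomialOfTerms ν (k + 1) l) := by
  have key (l : List (N × List ℕ)) (i : ℕ) :
      (MvPolynomial.finSuccEquiv B k (mvPolynomialOfTerms ν (k + 1) l)).coeff i =
        mvPolynomialOfTerms ν k ((l.filter fun t => decide (t.2.getD 0 0 = i)).map
          fun t => (t.1, t.2.tail)) := by
    induction l with
    | nil => simp [mvPolynomialOfTerms]
    | cons t l ih =>
      simp only [mvPolynomialOfTerms, List.map_cons, List.sum_cons, map_add, Polynomial.coeff_add]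
        at ih ⊢
      rw [ih, finSuccEquiv_monomial_exponentVector, Polynomial.coeff_monomial]
      by_cases h : t.2.getD 0 0 = i
      · rw [if_pos h, List.filter_cons_of_pos (by simpa using h), List.map_cons, List.map_cons,
          List.sum_cons]
      · rw [if_neg h, List.filter_cons_of_neg (by simpa using h), zero_add]
  ext1 i
  rw [toUnivariate, polynomialOfList_map_range (z := []) rfl, key]
  split_ifs with h
  · rfl
  · rw [List.filter_eq_nil_iff.2]
    · rfl
    · intro t ht
      have := List.le_sum_of_mem (List.mem_map_of_mem (f := fun t : N × List ℕ => t.2.getD 0 0 + 1) ht)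
      simp only [decide_eq_true_eq]
      lia

theorem finSuccEquiv_ofUnivariate (k : ℕ) (l : List (List (N × List ℕ))) :
    MvPolynomial.finSuccEquiv B k (mvPolynomialOfTerms ν (k + 1) (ofUnivariate l)) =
      polynomialOfList (mvPolynomialOfTerms ν k) l := by
  have key (i : ℕ) (l : List (N × List ℕ)) : MvPolynomial.finSuccEquiv B k
      (mvPolynomialOfTerms ν (k + 1) (l.map fun t => (t.1, i :: t.2))) =
        Polynomial.monomial i (mvPolynomialOfTerms ν k l) := by
    induction l with
    | nil => simp [mvPolynomialOfTerms]
    | cons t l ih =>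
      simp only [mvPolynomialOfTerms, List.map_cons, List.sum_cons, map_add] at ih ⊢
      rw [ih, finSuccEquiv_monomial_exponentVector]
      rfl
  ext1 i
  rw [ofUnivariate, mvPolynomialOfTerms_flatMap, ← List.sum_toFinset _ List.nodup_range,
    List.toFinset_range, map_sum, Polynomial.finsetSum_coeff,
    coeff_polynomialOfList (z := []) rfl]
  simp only [key, Polynomial.coeff_monomial]
  rw [Finset.sum_ite_eq']
  split_ifs with h
  · rfl
  · rw [List.getD_eq_default _ _ (by simpa using h)]
    rfl

variable {ν} [Primcodable N]

theorem IsComputableRing.mvPolynomialOfTerms [IsNoetherianRing B] (h : IsComputableRing ν)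
    (k : ℕ) : IsComputableRing (mvPolynomialOfTerms ν k) := by
  induction k with
  | zero =>
    obtain ⟨z, hz⟩ := h.surjective 0
    obtain ⟨add, hadd, add_spec⟩ := h.add
    have hexp (e e' : List ℕ) : exponentVector 0 e = exponentVector 0 e' := Subsingleton.elim _ _
    refine h.transfer (MvPolynomial.isEmptyRingEquiv B (Fin 0)).symm
      (φ := fun l => sumName z add (l.map Prod.fst)) (ψ := fun b => [(b, [])]) (by fun_prop)
      (by fun_prop) (fun l => ?_) (fun b => ?_)
    · rw [map_sumName hz add_spec, MvPolynomial.isEmptyRingEquiv_symm_apply]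
      induction l with
      | nil => simp [_root_.mvPolynomialOfTerms]
      | cons t l ih =>
        simp only [_root_.mvPolynomialOfTerms, List.map_cons, List.sum_cons, map_add] at ih ⊢
        rw [ih, Subsingleton.elim (exponentVector 0 t.2) 0]
        rfl
    · rw [MvPolynomial.isEmptyRingEquiv_symm_apply]
      simp only [_root_.mvPolynomialOfTerms, List.map_cons, List.map_nil, List.sum_cons,
        List.sum_nil, add_zero]
      rw [Subsingleton.elim (exponentVector 0 []) 0]
      rfl
  | succ k ih =>
    refine ih.polynomialOfList.transfer (MvPolynomial.finSuccEquiv B k).symm.toRingEquiv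
      (φ := toUnivariate) (ψ := ofUnivariate) ?_ ?_ (fun l => ?_) (fun l => ?_)
    · unfold toUnivariate
      fun_prop
    · unfold ofUnivariate
      fun_prop
    · rw [polynomialOfList_toUnivariate]
      exact (MvPolynomial.finSuccEquiv B k).symm_apply_apply _
    · rw [← finSuccEquiv_ofUnivariate]
      exact ((MvPolynomial.finSuccEquiv B k).symm_apply_apply _).symm

end MultivariateNames

section HomogeneousComponents

variable {R σ : Type*} [CommRing R] [SetLike σ R] [AddSubmonoidClass σ R] (𝒜 : ℤ → σ)
  [GradedRing 𝒜] {r p q : ℕ}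

/-- The homogeneous component of degree `s` of a matrix with row degrees `c` and column
degrees `d`. -/
def matrixComponent (c : Fin r → ℤ) (d : Fin p → ℤ) (s : ℤ) (V : Matrix (Fin r) (Fin p) R) :
    Matrix (Fin r) (Fin p) R :=
  Matrix.of fun i j => GradedRing.proj 𝒜 (s + c i - d j) (V i j)

theorem isHomogeneousMatrix_matrixComponent (c : Fin r → ℤ) (d : Fin p → ℤ) (s : ℤ)
    (V : Matrix (Fin r) (Fin p) R) :
    IsHomogeneousMatrix 𝒜 c d s (matrixComponent 𝒜 c d s V) := fun i j => by
  rw [matrixComponent, Matrix.of_apply, GradedRing.proj_apply]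
  exact SetLike.coe_mem _

theorem matrixComponent_zero (c : Fin r → ℤ) (d : Fin p → ℤ) (s : ℤ) :
    matrixComponent 𝒜 c d s (0 : Matrix (Fin r) (Fin p) R) = 0 := by
  ext
  simp [matrixComponent]

variable {𝒜}

theorem IsHomogeneousMatrix.matrixComponent_eq {c : Fin r → ℤ} {d : Fin p → ℤ} {s : ℤ}
    {V : Matrix (Fin r) (Fin p) R} (hV : IsHomogeneousMatrix 𝒜 c d s V) :
    matrixComponent 𝒜 c d s V = V := by
  ext i j
  rw [matrixComponent, Matrix.of_apply, GradedRing.proj_apply,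
    DirectSum.decompose_of_mem_same _ (hV i j)]

theorem IsHomogeneousMatrix.matrixComponent_mul {d : Fin p → ℤ} {e : Fin q → ℤ}
    {A : Matrix (Fin p) (Fin q) R} (hA : IsHomogeneousMatrix 𝒜 d e 0 A) (c : Fin r → ℤ) (s : ℤ)
    (V : Matrix (Fin r) (Fin p) R) :
    matrixComponent 𝒜 c d s V * A = matrixComponent 𝒜 c e s (V * A) := by
  ext i k
  rw [matrixComponent, matrixComponent, Matrix.of_apply, Matrix.mul_apply, Matrix.mul_apply,
    map_sum]
  refine Finset.sum_congr rfl fun j _ => ?_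
  rw [Matrix.of_apply, GradedRing.proj_apply, GradedRing.proj_apply,
    ← DirectSum.coe_decompose_mul_add_of_right_mem 𝒜 (hA j k),
    show s + c i - d j + (0 + d j - e k) = s + c i - e k by ring]

end HomogeneousComponents

section GradedNames

variable {N B : Type*} [CommRing B] (ν : N → B) (n : ℕ)

/-- The degree of a monomial in `n + 1` variables. -/
def termDegree (e : List ℕ) : ℤ := (((List.range (n + 1)).map fun i => e.getD i 0).sum : ℕ)

theorem monomial_mem_standardGrading (e : List ℕ) (b : B) :
    MvPolynomial.monomial (exponentOfList n e) b ∈ standardGrading B n (termDegree n e) := by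
  refine MvPolynomial.isWeightedHomogeneous_monomial _ _ _ ?_
  rw [Finsupp.weight_apply, Finsupp.sum_fintype _ _ (by simp), termDegree,
    ← List.sum_toFinset _ List.nodup_range, List.toFinset_range, Finset.sum_range]
  simp [exponentOfList]

/-- The terms of degree `m`. -/
def homogeneousTerms (m : ℤ) (l : List (N × List ℕ)) : List (N × List ℕ) :=
  l.filter fun t => decide (termDegree n t.2 = m)

theorem polynomialOfNames_cons (t : N × List ℕ) (l : List (N × List ℕ)) :
    polynomialOfNames ν n (t :: l) =
      MvPolynomial.monomial (exponentOfList n t.2) (ν t.1) + polynomialOfNames ν n l := rfl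

theorem proj_monomial (m : ℤ) (t : N × List ℕ) :
    GradedRing.proj (standardGrading B n) m (MvPolynomial.monomial (exponentOfList n t.2) (ν t.1)) =
      if termDegree n t.2 = m then MvPolynomial.monomial (exponentOfList n t.2) (ν t.1) else 0 := by
  have h := monomial_mem_standardGrading n t.2 (ν t.1)
  rw [GradedRing.proj_apply]
  split_ifs with hm
  · subst hm
    exact DirectSum.decompose_of_mem_same _ h
  · exact DirectSum.decompose_of_mem_ne _ h hm

theorem polynomialOfNames_homogeneousTerms (m : ℤ) (l : List (N × List ℕ)) :
    polynomialOfNames ν n (homogeneousTerms n m l) =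
      GradedRing.proj (standardGrading B n) m (polynomialOfNames ν n l) := by
  induction l with
  | nil => exact (map_zero _).symm
  | cons t l ih =>
    rw [polynomialOfNames_cons, map_add, proj_monomial, ← ih]
    by_cases h : termDegree n t.2 = m
    · rw [if_pos h, homogeneousTerms, List.filter_cons_of_pos (by simpa using h)]
      rfl
    · rw [if_neg h, homogeneousTerms, List.filter_cons_of_neg (by simpa using h), zero_add]
      rfl

theorem sum_proj_polynomialOfNames (S : Finset ℤ) (a b : ℤ) (l : List (N × List ℕ))
    (hl : ∀ t ∈ l, termDegree n t.2 + b - a ∈ S) :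
    ∑ s ∈ S, GradedRing.proj (standardGrading B n) (s + a - b) (polynomialOfNames ν n l) =
      polynomialOfNames ν n l := by
  induction l with
  | nil => exact Finset.sum_eq_zero fun s _ => map_zero _
  | cons t l ih =>
    simp only [polynomialOfNames_cons, map_add, Finset.sum_add_distrib, proj_monomial]
    rw [ih fun t' ht' => hl t' (List.mem_cons_of_mem _ ht'),
      Finset.sum_eq_single_of_mem _ (hl t List.mem_cons_self), if_pos (by ring)]
    exact fun s _ hs => if_neg fun h => hs (by rw [h]; ring)

/-- The sum of the first two arguments minus the third one. -/
def shiftedDegree (s a b : ℤ) : ℤ := s + a - b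

/-- A name of a homogeneous component of a matrix of polynomials. -/
def componentName (r p : ℕ) (c d : List ℤ) (s : ℤ) (V : List (List (List (N × List ℕ)))) :
    List (List (List (N × List ℕ))) :=
  matrixName r p fun i j =>
    homogeneousTerms n (shiftedDegree s (c.getD i 0) (d.getD j 0)) (nameAt [] V i j)

theorem matrixOfNames_componentName (r p : ℕ) (c d : List ℤ) (s : ℤ)
    (V : List (List (List (N × List ℕ)))) :
    matrixOfNames (polynomialOfNames ν n) r p (componentName n r p c d s V) =
      matrixComponent (standardGrading B n) (degreesOfList r c) (degreesOfList p d) s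
        (matrixOfNames (polynomialOfNames ν n) r p V) := by
  ext1 i j
  rw [componentName, matrixOfNames_matrixName, polynomialOfNames_homogeneousTerms,
    matrixComponent, Matrix.of_apply, matrixOfNames_apply (z := []) rfl]
  rfl

/-- The degrees of the homogeneous components of a matrix of polynomials. -/
def componentDegrees (r p : ℕ) (c d : List ℤ) (V : List (List (List (N × List ℕ)))) : List ℤ :=
  (List.range r).flatMap fun i => (List.range p).flatMap fun j => (nameAt [] V i j).map
    fun t => shiftedDegree (termDegree n t.2) (d.getD j 0) (c.getD i 0)

theorem sum_matrixComponent (r p : ℕ) (c d : List ℤ) (V : List (List (List (N × List ℕ)))) :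
    ∑ s ∈ (componentDegrees n r p c d V).toFinset, matrixComponent (standardGrading B n)
      (degreesOfList r c) (degreesOfList p d) s (matrixOfNames (polynomialOfNames ν n) r p V) =
        matrixOfNames (polynomialOfNames ν n) r p V := by
  ext1 i j
  rw [Matrix.sum_apply]
  simp only [matrixComponent, Matrix.of_apply]
  rw [matrixOfNames_apply (z := []) rfl]
  refine sum_proj_polynomialOfNames ν n _ _ _ _ fun t ht => List.mem_toFinset.2 ?_
  exact List.mem_flatMap.2 ⟨i, List.mem_range.2 i.2, List.mem_flatMap.2
    ⟨j, List.mem_range.2 j.2, List.mem_map.2 ⟨t, ht, rfl⟩⟩⟩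

/-- The homogeneous components of the solutions that `f` finds. -/
def homogeneousSolution {M : Type*}
    (f : M → Option (List (List (List (N × List ℕ))) × List (List (List (List (N × List ℕ))))))
    (r p : ℕ) (c d : List ℤ) (x : M) :
    Option (List (List (List (N × List ℕ))) × List (ℤ × List (List (List (N × List ℕ))))) :=
  (f x).map fun y => (componentName n r p c d 0 y.1, y.2.flatMap fun V =>
    (componentDegrees n r p c d V).map fun s => (s, componentName n r p c d s V))

variable {ν n}

theorem solutionSet_eq_affineSpan₀_components {r p q : ℕ} {c d : List ℤ} {e : Fin q → ℤ}
    {A : Matrix (Fin p) (Fin q) (MvPolynomial (Fin (n + 1)) B)}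
    {B' : Matrix (Fin r) (Fin q) (MvPolynomial (Fin (n + 1)) B)}
    (hA : IsHomogeneousMatrix (standardGrading B n) (degreesOfList p d) e 0 A)
    (hB : IsHomogeneousMatrix (standardGrading B n) (degreesOfList r c) e 0 B')
    {X₀ : List (List (List (N × List ℕ)))} {L : List (List (List (List (N × List ℕ))))}
    (h : solutionSet A B' = affineSpan₀ (R := MvPolynomial (Fin (n + 1)) B)
      (matrixOfNames (polynomialOfNames ν n) r p X₀)
      (L.map (matrixOfNames (polynomialOfNames ν n) r p))) :
    solutionSet A B' = affineSpan₀ (R := MvPolynomial (Fin (n + 1)) B)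
      (matrixOfNames (polynomialOfNames ν n) r p (componentName n r p c d 0 X₀))
      ((L.flatMap fun V => (componentDegrees n r p c d V).map
        fun s => (s, componentName n r p c d s V)).map
          fun Y => matrixOfNames (polynomialOfNames ν n) r p Y.2) := by
  rw [solutionSet_eq_affineSpan₀_iff] at h ⊢
  obtain ⟨h₀, hL⟩ := h
  refine ⟨?_, fun Y => ⟨fun hY => ?_, fun hY => ?_⟩⟩
  · rw [matrixOfNames_componentName, hA.matrixComponent_mul, ← h₀, hB.matrixComponent_eq]
  · refine (Submodule.span_le (p := LinearMap.ker (mulRightLinearMap (Fin r)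
      (MvPolynomial (Fin (n + 1)) B) A))).2 (fun Z hZ => ?_) hY
    obtain ⟨y, hy, rfl⟩ := List.mem_map.1 hZ
    obtain ⟨V, hV, hy⟩ := List.mem_flatMap.1 hy
    obtain ⟨s, hs, rfl⟩ := List.mem_map.1 hy
    change matrixOfNames (polynomialOfNames ν n) r p (componentName n r p c d s V) * A = 0
    rw [matrixOfNames_componentName, hA.matrixComponent_mul,
      (hL _).1 (Submodule.subset_span (List.mem_map_of_mem hV)), matrixComponent_zero]
  · refine Submodule.span_le.2 (fun Z hZ => ?_) ((hL Y).2 hY)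
    obtain ⟨V, hV, rfl⟩ := List.mem_map.1 hZ
    rw [← sum_matrixComponent ν n r p c d V]
    refine sum_mem fun s hs => Submodule.subset_span ?_
    exact List.mem_map.2 ⟨(s, componentName n r p c d s V), List.mem_flatMap.2 ⟨V, hV,
      List.mem_map.2 ⟨s, List.mem_toFinset.1 hs, rfl⟩⟩, matrixOfNames_componentName ν n r p c d s V⟩

variable {α : Type*} [Primcodable α] [Primcodable N]

namespace Computable

@[fun_prop]
theorem shiftedDegree {f g h : α → ℤ} (hf : Computable f) (hg : Computable g) (hh : Computable h) :
    Computable fun a => shiftedDegree (f a) (g a) (h a) :=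
  int_sub (int_add hf hg) hh

@[fun_prop]
theorem termDegree {e : α → List ℕ} (he : Computable e) :
    Computable fun a => termDegree n (e a) :=
  int_natCast (by fun_prop)

@[fun_prop]
theorem homogeneousTerms {m : α → ℤ} {l : α → List (N × List ℕ)} (hm : Computable m)
    (hl : Computable l) : Computable fun a => homogeneousTerms n (m a) (l a) := by
  unfold _root_.homogeneousTerms
  fun_prop

@[fun_prop]
theorem componentName {r p : α → ℕ} {c d : α → List ℤ} {s : α → ℤ}
    {V : α → List (List (List (N × List ℕ)))} (hr : Computable r) (hp : Computable p)
    (hc : Computable c) (hd : Computable d) (hs : Computable s) (hV : Computable V) :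
    Computable fun a => componentName n (r a) (p a) (c a) (d a) (s a) (V a) := by
  unfold _root_.componentName
  fun_prop

@[fun_prop]
theorem componentDegrees {r p : α → ℕ} {c d : α → List ℤ}
    {V : α → List (List (List (N × List ℕ)))} (hr : Computable r) (hp : Computable p)
    (hc : Computable c) (hd : Computable d) (hV : Computable V) :
    Computable fun a => componentDegrees n (r a) (p a) (c a) (d a) (V a) := by
  unfold _root_.componentDegrees
  fun_prop

end Computable

theorem IsComputableRing.isComputableGradedRing (h : IsComputableRing (polynomialOfNames ν n)) :
    IsComputableGradedRing (polynomialOfNames ν n) (standardGrading B n) := by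
  obtain ⟨eq, heq, eq_spec⟩ := ComputablePred.computable_iff.1 h.decidable_eq
  obtain ⟨f, hf, hfs⟩ := h.solve
  refine ⟨h, ComputablePred.computable_iff.2 ⟨fun x => eq (x.1, homogeneousTerms n x.2 x.1),
    by fun_prop, ?_⟩, fun x => homogeneousSolution n f x.1.1.1 x.1.1.2.1 x.2.1 x.2.2.1 x.1, ?_, ?_⟩
  · funext x
    rw [← congrFun eq_spec (x.1, homogeneousTerms n x.2 x.1)]
    simp only [polynomialOfNames_homogeneousTerms, GradedRing.proj_apply, eq_iff_iff]
    refine ⟨fun hx => (DirectSum.decompose_of_mem_same _ hx).symm, fun hx => ?_⟩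
    rw [hx]
    exact SetLike.coe_mem _
  · unfold homogeneousSolution
    fun_prop
  · intro r p q A B' c d e hA hB
    have key := hfs r p q A B'
    simp only [homogeneousSolution]
    generalize f ((r, p, q), A, B') = o at key ⊢
    obtain _ | ⟨X₀, L⟩ := o
    · exact key
    · refine ⟨?_, fun y hy => ?_, solutionSet_eq_affineSpan₀_components hA hB key⟩
      · rw [matrixOfNames_componentName]
        exact isHomogeneousMatrix_matrixComponent _ _ _ _ _
      · obtain ⟨V, -, hy⟩ := List.mem_flatMap.1 hy
        obtain ⟨s, -, rfl⟩ := List.mem_map.1 hy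
        rw [matrixOfNames_componentName]
        exact isHomogeneousMatrix_matrixComponent _ _ _ _ _

end GradedNames

section CosetRepresentatives

variable {N R : Type*} [CommRing R] [Primcodable N] {ν : N → R}

open Encodable

/-- In a computable ring, the element of a coset with the least name can be computed: membership in
a finitely generated ideal is decided by solving a linear equation. -/
theorem IsComputableRing.hasEffectiveCosetRepresentatives (h : IsComputableRing ν) :
    HasEffectiveCosetRepresentatives ν := by
  obtain ⟨h, f, hf, hfs⟩ := isComputableRing_iff.1 h
  obtain ⟨z, hz⟩ := h.surjective 0
  obtain ⟨add, hadd, add_spec⟩ := h.add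
  obtain ⟨neg, hneg, neg_spec⟩ := h.neg
  let T (I : Ideal R) : Set R :=
    {t | ∃ x, ν x = t ∧ ∀ y, ν x - ν y ∈ I → encode x ≤ encode y}
  have hT {I : Ideal R} {b : N} {x : N} (hx : ν b - ν x ∈ I)
      (hmin : ∀ y, ν b - ν y ∈ I → encode x ≤ encode y) : ν x ∈ T I :=
    ⟨x, rfl, fun y hy => hmin y (by simpa using add_mem hx hy)⟩
  let test (a : List N × N) (x : N) : Bool :=
    (f ((1, a.1.length, 1), a.1.map (fun y => [y]), [[add (a.2, neg x)]])).isSome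
  have test_iff (l : List N) (b x : N) : test (l, b) x = true ↔
      ν b - ν x ∈ Ideal.span {g | ∃ y ∈ l, ν y = g} := by
    have hset : {g | ∃ y ∈ l, ν y = g} = Set.range fun i : Fin l.length => ν l[i] := by
      ext g
      simp [List.mem_iff_get, eq_comm]
    rw [hset, Ideal.mem_span_range_iff_exists_fun, hfs.isSome_iff]
    have hl (i : Fin l.length) :
        matrixOfNames ν l.length 1 (l.map fun y => [y]) i 0 = ν l[i] := by
      simp [matrixOfNames]
    have hb : matrixOfNames ν 1 1 [[add (b, neg x)]] 0 0 = ν b - ν x := by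
      simp [matrixOfNames, add_spec, neg_spec, sub_eq_add_neg]
    refine ⟨fun ⟨V, hV⟩ => ⟨V 0, ?_⟩, fun ⟨c, hc⟩ => ⟨Matrix.of fun _ => c, ?_⟩⟩
    · rw [← hb, hV, Matrix.mul_apply]
      simp only [hl]
    · ext i j
      rw [Subsingleton.elim i 0, Subsingleton.elim j 0, hb, Matrix.mul_apply, ← hc]
      simp only [hl, Matrix.of_apply]
  have htest : Computable fun x : (List N × N) × ℕ =>
      (decode₂ N x.2).elim false fun y => test x.1 y :=
    Computable.option_elim (Primrec.decode₂.to_comp.comp Computable.snd) (by fun_prop)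
      (by simp only [test]; fun_prop)
  obtain ⟨g, hg, hg_spec⟩ := Computable.exists_nat_search
    (p := fun a n => (decode₂ N n).elim false fun y => test a y) htest fun a =>
      ⟨encode a.2, by
        rw [encodek₂, Option.elim_some, test_iff, sub_self]
        exact zero_mem _⟩
  refine ⟨T, fun I b => ?_, fun a => (decode₂ N (g a)).getD a.2,
    Computable.option_getD (Primrec.decode₂.to_comp.comp hg) Computable.snd, fun l b => ?_⟩
  · obtain ⟨b, rfl⟩ := h.surjective b
    obtain ⟨x, hx, hmin⟩ := WellFounded.has_min (measure (encode : N → ℕ)).wf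
      {x | ν b - ν x ∈ I} ⟨b, by simp⟩
    refine ⟨ν x, ⟨hT hx fun y hy => not_lt.1 (hmin y hy), hx⟩, ?_⟩
    rintro _ ⟨⟨y, rfl, hy⟩, hby⟩
    have hxy := hy x (by simpa using sub_mem hx hby)
    rw [encode_injective (le_antisymm hxy (not_lt.1 (hmin y hby)))]
  · obtain ⟨hga, hmin⟩ := hg_spec (l, b)
    cases hx : decode₂ N (g (l, b)) with
    | none => simp [hx] at hga
    | some x =>
      rw [hx, Option.elim_some, test_iff] at hga
      simp only [hx, Option.getD_some]
      refine ⟨hT hga fun y hy => ?_, hga⟩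
      rw [decode₂_eq_some.1 hx]
      by_contra! hlt
      have := hmin _ hlt
      rw [encodek₂, Option.elim_some, (test_iff l b y).2 hy] at this
      exact Bool.false_ne_true this.symm

end CosetRepresentatives

theorem proposition4p3 {B N : Type*} [CommRing B] [IsNoetherianRing B] [Primcodable N]
    (ν : N → B) (hcomp : IsComputableRing ν) (hcoset : HasEffectiveCosetRepresentatives ν)
    (n : ℕ) :
    IsComputableGradedRing (polynomialOfNames ν n) (standardGrading B n) ∧
      HasEffectiveCosetRepresentatives (polynomialOfNames ν n) := by
  have h : IsComputableRing (polynomialOfNames ν n) := hcomp.mvPolynomialOfTerms (n + 1)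
  exact ⟨h.isComputableGradedRing, h.hasEffectiveCosetRepresentatives⟩
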